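/- Let $G_{\mathbb R}$ be a connected simple linear real Lie group, i.e. a connected closed subgroup of $\mathrm{GL}_n(\mathbb C)$ for some $n$ whose real Lie algebra $\mathfrak g_{\mathbb R}=\{X\in M_n(\mathbb C) : \exp(tX)\in G_{\mathbb R}\text{ for all }t\in\mathbb R\}$ is simple. For $x\in\mathfrak g_{\mathbb R}$ let $G_{\mathbb R}\cdot x=\{\mathrm{Ad}(g)(x)=gxg^{-1} : g\in G_{\mathbb R}\}$ be its adjoint orbit. Call $x$ nilpotent if the endomorphism $\mathrm{ad}(x)$ of $\mathfrak g_{\mathbb R}$ is nilpotent, and semisimple if $\mathrm{ad}(x)$ is diagonalizable over $\mathbb C$. Let $\mathcal N(\mathfrak g_{\mathbb R})$ be the nilpotent cone, i.e. the set of nilpotent elements of $\mathfrak g_{\mathbb R}$; a nilpotent orbit is the orbit $G_{\mathbb R}\cdot e$ of an element $e\in\mathcal N(\mathfrak g_{\mathbb R})$. With closures taken in the usual topology of $\mathfrak g_{\mathbb R}$, define the limit of orbits $$\lim_{\nu\to 0^+}G_{\mathbb R}\cdot(\nu x):=\bigcap_{\epsilon>0}\overline{\bigcup_{\nu\in(0,\epsilon)}G_{\mathbb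 R}\cdot(\nu x)}.$$ **Proposition 3.2.** Let $x\in\mathfrak g_{\mathbb R}$ with Jordan decomposition $x=x_s+x_n$, where $x_s,x_n\in\mathfrak g_{\mathbb R}$, $x_s$ is semisimple, $x_n$ is nilpotent and $[x_s,x_n]=0$. (a) The set $\lim_{\nu\to 0^+}G_{\mathbb R}\cdot(\nu x)$ is nonempty, closed, $G_{\mathbb R}$-stable and contained in $\mathcal N(\mathfrak g_{\mathbb R})$. It is a finite union of nilpotent orbits. (b) The nilpotent part $x_n$ belongs to $\lim_{\nu\to 0^+}G_{\mathbb R}\cdot(\nu x)$, and $\overline{G_{\mathbb R}\cdot x_n}\subset\lim_{\nu\to 0^+}G_{\mathbb R}\cdot(\nu x)$. (c) $\lim_{\nu\to 0^+}G_{\mathbb R}\cdot(\nu x_s)\subset\lim_{\nu\to 0^+}G_{\mathbb R}\cdot(\nu x)$. (d) If $x$ is nilpotent, then $\lim_{\nu\to 0^+}G_{\mathbb R}\cdot(\nu x)=\overline{G_{\mathbb R}\cdot x}$. -/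

import Mathlib

open Filter Topology Set

attribute [local instance 100] LieRing.ofAssociativeRing

namespace LimitOrbits

/-! ### Convergence facts needed to see that the Lie algebra of a closed linear group is one -/

section Convergence

variable {A : Type*} [NormedRing A] [NormOneClass A]

theorem norm_pow_sub_pow_le {a b : A} {M : ℝ} (hM : 1 ≤ M) (ha : ‖a‖ ≤ M) (hb : ‖b‖ ≤ M)
    (k : ℕ) : ‖a ^ k - b ^ k‖ ≤ k * M ^ k * ‖a - b‖ := by
  induction k with
  | zero => simp
  | succ k ih =>
    have h0 : (0 : ℝ) ≤ M := by linarith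
    have e : a ^ (k + 1) - b ^ (k + 1) = a ^ k * (a - b) + (a ^ k - b ^ k) * b := by
      simp only [pow_succ]; noncomm_ring
    have h1 : ‖a ^ k‖ ≤ M ^ k := (norm_pow_le a k).trans (pow_le_pow_left₀ (norm_nonneg _) ha k)
    have h2 : ‖a ^ k * (a - b)‖ ≤ M ^ (k + 1) * ‖a - b‖ := by
      refine (norm_mul_le _ _).trans ?_
      have : M ^ k ≤ M ^ (k + 1) := pow_le_pow_right₀ hM (Nat.le_succ k)
      gcongr
      exact h1.trans this
    have h3 : ‖(a ^ k - b ^ k) * b‖ ≤ (k * M ^ k * ‖a - b‖) * M := by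
      refine (norm_mul_le _ _).trans ?_
      gcongr
    rw [e]
    refine (norm_add_le _ _).trans ((add_le_add h2 h3).trans (le_of_eq ?_))
    push_cast
    ring

theorem norm_le_of_smul_sub [NormedAlgebra ℝ A] {a : A} {C : ℝ} {k : ℕ} (hk : 0 < k)
    (h : ‖(k : ℝ) • (a - 1)‖ ≤ C) : ‖a‖ ≤ 1 + C / k := by
  have hk' : (0 : ℝ) < k := by exact_mod_cast hk
  rw [norm_smul, Real.norm_of_nonneg hk'.le] at h
  have h1 : ‖a - 1‖ ≤ C / k := by rw [le_div_iff₀ hk']; linarith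
  calc ‖a‖ = ‖1 + (a - 1)‖ := by congr 1; abel
    _ ≤ ‖(1 : A)‖ + ‖a - 1‖ := norm_add_le _ _
    _ ≤ 1 + C / k := by rw [norm_one]; linarith

theorem tendsto_pow_sub_pow [NormedAlgebra ℝ A] {a b : ℕ → A} {X : A}
    (ha : Tendsto (fun k : ℕ => (k : ℝ) • (a k - 1)) atTop (𝓝 X))
    (hb : Tendsto (fun k : ℕ => (k : ℝ) • (b k - 1)) atTop (𝓝 X)) :
    Tendsto (fun k => a k ^ k - b k ^ k) atTop (𝓝 0) := by
  have hd : Tendsto (fun k : ℕ => (k : ℝ) * ‖a k - b k‖) atTop (𝓝 0) := by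
    have h := (ha.sub hb).norm
    rw [sub_self, norm_zero] at h
    refine h.congr fun k => ?_
    rw [← smul_sub, sub_sub_sub_cancel_right, norm_smul, Real.norm_of_nonneg (Nat.cast_nonneg k)]
  set C : ℝ := ‖X‖ + 1
  have hC : 0 ≤ C := by positivity
  have hlt : ‖X‖ < C := lt_add_one _
  have h0 : Tendsto (fun k : ℕ => Real.exp C * ((k : ℝ) * ‖a k - b k‖)) atTop (𝓝 0) := by
    simpa using hd.const_mul (Real.exp C)
  refine squeeze_zero_norm' ?_ h0
  filter_upwards [ha.norm.eventually_lt_const hlt, hb.norm.eventually_lt_const hlt,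
    eventually_gt_atTop 0] with k h1 h2 hk
  have hk' : (0 : ℝ) < k := by exact_mod_cast hk
  have hM : (1 : ℝ) ≤ 1 + C / k := le_add_of_nonneg_right (by positivity)
  have h4 := norm_pow_sub_pow_le hM (norm_le_of_smul_sub hk h1.le)
    (norm_le_of_smul_sub hk h2.le) k
  have h5 : (1 + C / k) ^ k ≤ Real.exp C := by
    calc (1 + C / k) ^ k ≤ Real.exp (C / k) ^ k := by
          gcongr
          rw [add_comm]
          exact Real.add_one_le_exp _
      _ = Real.exp C := by
          rw [← Real.exp_nat_mul]
          congr 1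
          field_simp
  calc ‖a k ^ k - b k ^ k‖ ≤ k * (1 + C / k) ^ k * ‖a k - b k‖ := h4
    _ ≤ k * Real.exp C * ‖a k - b k‖ := by gcongr
    _ = Real.exp C * ((k : ℝ) * ‖a k - b k‖) := by ring

theorem tendsto_smul_sub_of_hasDerivAt [NormedAlgebra ℝ A] {γ : ℝ → A} {X : A} (h0 : γ 0 = 1)
    (h : HasDerivAt γ X 0) :
    Tendsto (fun k : ℕ => (k : ℝ) • (γ ((k : ℝ)⁻¹) - 1)) atTop (𝓝 X) := by
  have h1 := hasDerivAt_iff_tendsto_slope_zero.1 h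
  have h2 : Tendsto (fun k : ℕ => ((k : ℝ))⁻¹) atTop (𝓝[≠] 0) := by
    refine tendsto_nhdsWithin_iff.2 ⟨tendsto_inv_atTop_nhds_zero_nat, ?_⟩
    filter_upwards [eventually_gt_atTop 0] with k hk
    have : (k : ℝ) ≠ 0 := by exact_mod_cast hk.ne'
    exact inv_ne_zero this
  refine (h1.comp h2).congr fun k => ?_
  simp [h0]

/-- If `γ` is a curve with `γ 0 = 1` and `γ' 0 = X`, then `γ (1/k) ^ k → exp X`. -/
theorem tendsto_curve_pow [NormedAlgebra ℝ A] [CompleteSpace A] {γ : ℝ → A} {X : A}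
    (h0 : γ 0 = 1) (h : HasDerivAt γ X 0) :
    Tendsto (fun k : ℕ => γ ((k : ℝ)⁻¹) ^ k) atTop (𝓝 (NormedSpace.exp X)) := by
  have hb : HasDerivAt (fun u : ℝ => NormedSpace.exp (u • X)) X 0 := by
    simpa using hasDerivAt_exp_smul_const (𝕂 := ℝ) X 0
  have h1 := tendsto_pow_sub_pow (tendsto_smul_sub_of_hasDerivAt h0 h)
    (tendsto_smul_sub_of_hasDerivAt (by simp) hb)
  have h2 : Tendsto (fun k : ℕ => NormedSpace.exp (((k : ℝ)⁻¹) • X) ^ k) atTop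
      (𝓝 (NormedSpace.exp X)) := by
    refine tendsto_const_nhds.congr' ?_
    filter_upwards [eventually_gt_atTop 0] with k hk
    have hk' : (k : ℝ) ≠ 0 := by exact_mod_cast hk.ne'
    let _ : NormedAlgebra ℚ A := NormedAlgebra.restrictScalars ℚ ℝ A
    rw [← NormedSpace.exp_nsmul, ← Nat.cast_smul_eq_nsmul ℝ, smul_smul, mul_inv_cancel₀ hk',
      one_smul]
  simpa using h1.add h2

end Convergence

/-! ### One-parameter subgroups contained in a closed group of units -/

section OneParameter

/-- `X` generates a one-parameter subgroup of `G`: `exp (t X) ∈ G` for every real `t`. -/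
def ExpMem {A : Type*} [Ring A] [Algebra ℝ A] [TopologicalSpace A] [IsTopologicalRing A]
    (G : Subgroup Aˣ) (X : A) : Prop :=
  ∀ t : ℝ, ∃ g ∈ G, (g : A) = NormedSpace.exp (t • X)

variable {A : Type*} [NormedRing A] [NormedAlgebra ℝ A] [CompleteSpace A]

theorem hasDerivAt_exp_smul_zero (X : A) :
    HasDerivAt (fun u : ℝ => NormedSpace.exp (u • X)) X 0 := by
  simpa using hasDerivAt_exp_smul_const (𝕂 := ℝ) X 0

theorem exp_mem_of_curve [NormOneClass A] {G : Subgroup Aˣ} (hG : IsClosed (G : Set Aˣ)) {X : A}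
    {γ : ℝ → A} (hγ : ∀ t, ∃ g ∈ G, (g : A) = γ t)
    (h0 : γ 0 = 1) (h : HasDerivAt γ X 0) :
    ∃ g ∈ G, (g : A) = NormedSpace.exp X := by
  choose g hg hgγ using hγ
  have h1 := tendsto_curve_pow h0 h
  let _ : NormedAlgebra ℚ A := NormedAlgebra.restrictScalars ℚ ℝ A
  obtain ⟨u, hu⟩ := NormedSpace.isUnit_exp X
  rw [← hu] at h1
  have h2 : Tendsto (fun k : ℕ => g ((k : ℝ)⁻¹) ^ k) atTop (𝓝 u) := by
    rw [(Units.isOpenEmbedding_val (R := A)).tendsto_nhds_iff]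
    refine h1.congr fun k => ?_
    simp [hgγ]
  exact ⟨u, hG.mem_of_tendsto h2 (Eventually.of_forall fun k => G.pow_mem (hg _) k), hu⟩

theorem expMem_of_curve [NormOneClass A] {G : Subgroup Aˣ} (hG : IsClosed (G : Set Aˣ)) {X : A}
    {γ : ℝ → A} (hγ : ∀ t, ∃ g ∈ G, (g : A) = γ t)
    (h0 : γ 0 = 1) (h : HasDerivAt γ X 0) : ExpMem G X := by
  intro t
  refine exp_mem_of_curve hG (γ := fun s => γ (t * s)) (fun s => hγ _) (by simpa using h0) ?_
  have h' : HasDerivAt γ X (t * 0) := by simpa using h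
  have h2 : HasDerivAt (fun s : ℝ => t * s) t 0 := by
    simpa using (hasDerivAt_id (0 : ℝ)).const_mul t
  exact h'.scomp (0 : ℝ) h2

theorem ExpMem.smul {G : Subgroup Aˣ} {X : A} (hX : ExpMem G X) (c : ℝ) :
    ExpMem G (c • X) := fun t => by
  simpa [smul_smul] using hX (t * c)

theorem ExpMem.add [NormOneClass A] {G : Subgroup Aˣ} (hG : IsClosed (G : Set Aˣ))
    {X Y : A} (hX : ExpMem G X) (hY : ExpMem G Y) : ExpMem G (X + Y) := by
  refine expMem_of_curve hG
    (γ := fun t => NormedSpace.exp (t • X) * NormedSpace.exp (t • Y)) (fun t => ?_) (by simp) ?_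
  · obtain ⟨g, hg, hgX⟩ := hX t
    obtain ⟨k, hk, hkY⟩ := hY t
    exact ⟨g * k, G.mul_mem hg hk, by simp [hgX, hkY]⟩
  · have := (hasDerivAt_exp_smul_zero X).mul (hasDerivAt_exp_smul_zero Y)
    simp only [zero_smul, NormedSpace.exp_zero, mul_one, one_mul] at this
    exact this

theorem ExpMem.conj {G : Subgroup Aˣ} {X : A} (hX : ExpMem G X) {g : Aˣ} (hg : g ∈ G) :
    ExpMem G ((g : A) * X * ((g⁻¹ : Aˣ) : A)) := by
  intro t
  obtain ⟨k, hk, hkX⟩ := hX t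
  refine ⟨g * k * g⁻¹, G.mul_mem (G.mul_mem hg hk) (G.inv_mem hg), ?_⟩
  let _ : NormedAlgebra ℚ A := NormedAlgebra.restrictScalars ℚ ℝ A
  have := NormedSpace.exp_units_conj g (t • X)
  rw [Units.val_mul, Units.val_mul, hkX, ← this]
  simp

theorem ExpMem.lie [NormOneClass A] [FiniteDimensional ℝ A] {G : Subgroup Aˣ}
    (hG : IsClosed (G : Set Aˣ)) {X Y : A} (hX : ExpMem G X) (hY : ExpMem G Y) :
    ExpMem G ⁅X, Y⁆ := by
  have hd : HasDerivAt
      (fun u : ℝ => NormedSpace.exp (u • X) * Y * NormedSpace.exp (u • (-X))) ⁅X, Y⁆ 0 := by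
    have := ((hasDerivAt_exp_smul_zero X).mul_const Y).mul (hasDerivAt_exp_smul_zero (-X))
    simp only [zero_smul, NormedSpace.exp_zero, mul_one, one_mul, mul_neg, ← sub_eq_add_neg]
      at this
    exact this
  have hlim := hasDerivAt_iff_tendsto_slope_zero.1 hd
  let S : Submodule ℝ A :=
    { carrier := {X | ExpMem G X}
      zero_mem' := fun t => ⟨1, G.one_mem, by simp⟩
      add_mem' := fun hX hY => ExpMem.add hG hX hY
      smul_mem' := fun c _ hX => ExpMem.smul hX c }
  have hcl : IsClosed (S : Set A) := Submodule.closed_of_finiteDimensional _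
  refine hcl.mem_of_tendsto hlim (Eventually.of_forall fun t => ?_)
  refine S.smul_mem _ (S.sub_mem ?_ ?_)
  · obtain ⟨g, hg, hgX⟩ := hX t
    have h1 : ((g⁻¹ : Aˣ) : A) = NormedSpace.exp (t • (-X)) := by
      let _ : NormedAlgebra ℚ A := NormedAlgebra.restrictScalars ℚ ℝ A
      refine Units.inv_eq_of_mul_eq_one_right ?_
      rw [hgX, smul_neg, ← NormedSpace.exp_add_of_commute (Commute.neg_right rfl)]
      simp
    have h2 := hY.conj hg
    rw [hgX, h1] at h2
    rw [zero_add]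
    exact h2
  · have h2 : ExpMem G Y := hY
    simp only [zero_smul, NormedSpace.exp_zero, mul_one, one_mul]
    exact h2

end OneParameter

/-! ### The Lie algebra of a closed linear group -/

section LieAlgebraOfGroup

variable {n : ℕ} {G : Subgroup (GL (Fin n) ℂ)} {X Y : Matrix (Fin n) (Fin n) ℂ}

theorem expMem_of_eq_zero (hn : n = 0) : ExpMem G X := by
  subst hn
  exact fun t => ⟨1, G.one_mem, Subsingleton.elim _ _⟩

theorem expMem_matrix_smul (hX : ExpMem G X) (c : ℝ) : ExpMem G (c • X) := by
  let _ : NormedRing (Matrix (Fin n) (Fin n) ℂ) := Matrix.linftyOpNormedRing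
  let _ : NormedAlgebra ℝ (Matrix (Fin n) (Fin n) ℂ) := Matrix.linftyOpNormedAlgebra
  exact ExpMem.smul hX c

theorem expMem_matrix_add (hG : IsClosed (G : Set (GL (Fin n) ℂ))) (hX : ExpMem G X)
    (hY : ExpMem G Y) : ExpMem G (X + Y) := by
  let _ : NormedRing (Matrix (Fin n) (Fin n) ℂ) := Matrix.linftyOpNormedRing
  let _ : NormedAlgebra ℝ (Matrix (Fin n) (Fin n) ℂ) := Matrix.linftyOpNormedAlgebra
  rcases Nat.eq_zero_or_pos n with hn | hn
  · exact expMem_of_eq_zero hn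
  · have : Nonempty (Fin n) := ⟨⟨0, hn⟩⟩
    have : NormOneClass (Matrix (Fin n) (Fin n) ℂ) := Matrix.linfty_opNormOneClass
    exact ExpMem.add hG hX hY

theorem expMem_matrix_conj (hX : ExpMem G X) {g : GL (Fin n) ℂ} (hg : g ∈ G) :
    ExpMem G ((g : Matrix (Fin n) (Fin n) ℂ) * X *
      ((g⁻¹ : GL (Fin n) ℂ) : Matrix (Fin n) (Fin n) ℂ)) := by
  let _ : NormedRing (Matrix (Fin n) (Fin n) ℂ) := Matrix.linftyOpNormedRing
  let _ : NormedAlgebra ℝ (Matrix (Fin n) (Fin n) ℂ) := Matrix.linftyOpNormedAlgebra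
  exact ExpMem.conj hX hg

theorem expMem_matrix_lie (hG : IsClosed (G : Set (GL (Fin n) ℂ))) (hX : ExpMem G X)
    (hY : ExpMem G Y) : ExpMem G ⁅X, Y⁆ := by
  let _ : NormedRing (Matrix (Fin n) (Fin n) ℂ) := Matrix.linftyOpNormedRing
  let _ : NormedAlgebra ℝ (Matrix (Fin n) (Fin n) ℂ) := Matrix.linftyOpNormedAlgebra
  rcases Nat.eq_zero_or_pos n with hn | hn
  · exact expMem_of_eq_zero hn
  · have : Nonempty (Fin n) := ⟨⟨0, hn⟩⟩
    have : NormOneClass (Matrix (Fin n) (Fin n) ℂ) := Matrix.linfty_opNormOneClass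
    exact ExpMem.lie hG hX hY

/-- The (real) Lie algebra `{X | exp (t X) ∈ G for all real t}` of a closed subgroup `G` of
`GL(n, ℂ)`, with the commutator bracket. -/
def lieAlg (G : Subgroup (GL (Fin n) ℂ)) (hG : IsClosed (G : Set (GL (Fin n) ℂ))) :
    LieSubalgebra ℝ (Matrix (Fin n) (Fin n) ℂ) where
  carrier := {X | ExpMem G X}
  zero_mem' := fun t => ⟨1, G.one_mem, by simp⟩
  add_mem' := fun hX hY => expMem_matrix_add hG hX hY
  smul_mem' := fun c _ hX => expMem_matrix_smul hX c
  lie_mem' := fun hX hY => expMem_matrix_lie hG hX hY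

end LieAlgebraOfGroup

section Orbits

variable {n : ℕ} {G : Subgroup (GL (Fin n) ℂ)} {hG : IsClosed (G : Set (GL (Fin n) ℂ))}

/-- The adjoint action `Ad(g) X = g X g⁻¹` of `G` on its Lie algebra. -/
def Ad (g : G) (X : lieAlg G hG) : lieAlg G hG :=
  ⟨((g : GL (Fin n) ℂ) : Matrix (Fin n) (Fin n) ℂ) * (X : Matrix (Fin n) (Fin n) ℂ) *
      (((g : GL (Fin n) ℂ)⁻¹ : GL (Fin n) ℂ) : Matrix (Fin n) (Fin n) ℂ),
    expMem_matrix_conj X.2 g.2⟩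

/-- The adjoint orbit `G · x`. -/
def orbit (x : lieAlg G hG) : Set (lieAlg G hG) := Set.range fun g : G => Ad g x

/-- The limit of orbits `lim_{ν → 0⁺} G · (ν x)`, i.e. the intersection over `ε > 0` of the closures
of the unions of the orbits `G · (ν x)` with `0 < ν < ε`. -/
def limitOrbits (x : lieAlg G hG) : Set (lieAlg G hG) :=
  ⋂ ε : ℝ, ⋂ _ : 0 < ε, closure (⋃ ν ∈ Set.Ioo (0 : ℝ) ε, orbit (ν • x))

end Orbits

/-! ### Nilpotent and semisimple elements of a real Lie algebra -/

section Elements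

variable {L : Type*} [LieRing L] [LieAlgebra ℝ L]

/-- `x` is nilpotent if the endomorphism `ad x` is nilpotent. -/
def IsNilpotentElt (x : L) : Prop := IsNilpotent (LieAlgebra.ad ℝ L x)

/-- `x` is semisimple if the endomorphism `ad x` is diagonalizable over `ℂ`: the eigenspaces of its
complexification span. -/
def IsSemisimpleElt (x : L) : Prop :=
  ⨆ μ : ℂ, Module.End.eigenspace ((LieAlgebra.ad ℝ L x).baseChange ℂ) μ = ⊤

/-- `x = s + e` is the Jordan decomposition of `x`. -/
structure IsJordanDecomposition (x s e : L) : Prop where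
  eq_add : x = s + e
  semisimple : IsSemisimpleElt s
  nilpotent : IsNilpotentElt e
  commute : ⁅s, e⁆ = 0

variable (L) in
/-- The nilpotent cone. -/
def nilpotentCone : Set L := {x | IsNilpotentElt x}

end Elements

end LimitOrbits

namespace LimitOrbits

/-! ### Linear algebra of `sl₂`-relations -/

section Operators

open Module Module.End

variable {M : Type*} [AddCommGroup M] [Module ℝ M]

/-! Simplicity enters only through nondegeneracy of the Killing form. For nilpotent `e`, invariance
of the form gives `e ∈ [e, L]`, and then an `sl₂`-triple `(e, h, f)` (Jacobson–Morozov).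
One-parameter groups `exp (t h)` in `G` rescale the eigenvectors of `ad h`.

If `x = s + e` is a Jordan decomposition, there is `h` commuting with `s` such that `[h, e] = e`, so
`G · (ν x)` contains `ν s + ν c e` for every `c > 0`. Taking `c = 1/ν` and `ν → 0` gives `e` in the
limit; letting `c → 0` puts `ν s` in the closure of `G · (ν x)`. For `x` nilpotent all the `ν x`
with `ν > 0` lie in one orbit, so the limit is the closure of that orbit.

The limit is nilpotent because the characteristic polynomial of `ad` is continuous and
`Ad`-invariant and `ν x → 0`. What remains is the finiteness of the set of nilpotent orbits. The
slice `e + ker (ad f)` is transverse to the orbit of `e`, so nearby elements are conjugate into it.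
A scaled one-parameter group expands the slice away from `e`, keeping nilpotent elements in their
orbits, so every nearby nilpotent orbit other than that of `e` meets a compact sphere in the slice.
On the nilpotent part of that sphere `ad` has larger rank than at `e`, so induction on corank and
compactness show that each nilpotent element has a neighbourhood meeting finitely many nilpotent
orbits. Scaling brings every nilpotent orbit into such a neighbourhood of `0`. -/

theorem pow_semiconj_of_weight_two {E H : End ℝ M} (hE : H * E = E * H + (2 : ℝ) • E) (k : ℕ) :
    H * E ^ k = E ^ k * H + (2 * k : ℝ) • E ^ k := by
  induction k with
  | zero => simp
  | succ k ih =>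
    rw [pow_succ, ← mul_assoc, ih, add_mul, mul_assoc, hE, mul_add, smul_mul_assoc,
      mul_smul_comm, ← mul_assoc, add_assoc, ← add_smul]
    push_cast
    ring_nf

theorem pow_succ_mul_lowering {E H W : End ℝ M} (hE : H * E = E * H + (2 : ℝ) • E)
    (hW : E * W = W * E + H) (k : ℕ) :
    E ^ (k + 1) * W = W * E ^ (k + 1) + (k + 1 : ℝ) • (H * E ^ k - (k : ℝ) • E ^ k) := by
  induction k with
  | zero => simp [hW]
  | succ k ih =>
    have h1 : E * H = H * E - (2 : ℝ) • E := by rw [hE]; abel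
    rw [pow_succ' E (k + 1), mul_assoc, ih, mul_add, ← mul_assoc E W, hW, add_mul,
      mul_smul_comm, mul_sub, mul_smul_comm, ← mul_assoc E H, h1, sub_mul, smul_mul_assoc,
      mul_assoc H E, mul_assoc W E, ← pow_succ' E k, ← pow_succ' E (k + 1)]
    push_cast
    module

variable {E H W : End ℝ M}

/-- Write `x = E ^ k y` and apply the commutation formula for `E ^ (k + 1) * W` to `y`: the term in
`E ^ (k + 1) y = E x` vanishes, so modulo `range (E ^ (k + 1))` the operator `H` acts on `x` by the
scalar `k`. -/
theorem sub_smul_mem_range_pow_of_ker (hE : H * E = E * H + (2 : ℝ) • E)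
    (hW : E * W = W * E + H) {k : ℕ} {x : M} (hx : E x = 0)
    (hk : x ∈ LinearMap.range (E ^ k)) :
    H x - (k : ℝ) • x ∈ LinearMap.range (E ^ (k + 1)) := by
  obtain ⟨y, rfl⟩ := hk
  have h := congrArg (fun T : End ℝ M => T y) (pow_succ_mul_lowering hE hW k)
  have h0 : (E ^ (k + 1)) y = 0 := by rw [pow_succ']; exact hx
  simp only [LinearMap.add_apply, Module.End.mul_apply, LinearMap.smul_apply, LinearMap.sub_apply,
    h0, map_zero, zero_add] at h
  have hk : (k + 1 : ℝ) ≠ 0 := by positivity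
  refine ⟨(k + 1 : ℝ)⁻¹ • W y, ?_⟩
  rw [map_smul, h, smul_smul, inv_mul_cancel₀ hk, one_smul]

theorem ker_apply_of_weight_two (hE : H * E = E * H + (2 : ℝ) • E) {x : M} (hx : E x = 0) :
    E (H x) = 0 := by
  have h := congrArg (fun T : End ℝ M => T x) hE
  simpa [hx] using h.symm

/-- The kernel of a nilpotent raising operator is spanned by weight vectors whose weights are
natural numbers. -/
theorem ker_inf_range_pow_le_iSup (hE : H * E = E * H + (2 : ℝ) • E)
    (hW : E * W = W * E + H) (hnil : IsNilpotent E) (k : ℕ) :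
    LinearMap.ker E ⊓ LinearMap.range (E ^ k) ≤
      ⨆ m : ℕ, if k ≤ m then eigenspace H (m : ℝ) ⊓ LinearMap.ker E else ⊥ := by
  obtain ⟨N, hN⟩ := hnil
  -- Descending induction on `k`, starting where `E ^ k = 0`.
  obtain ⟨j, hj⟩ : ∃ j, N ≤ k + j := ⟨N, by omega⟩
  induction j generalizing k with
  | zero =>
    rintro x ⟨-, y, rfl⟩
    have : E ^ k = 0 := pow_eq_zero_of_le hj hN
    simp [this]
  | succ j ih =>
    rintro x ⟨hx, hxk⟩
    have h1 := ih (k + 1) (by omega)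
      ⟨show E (H x - (k : ℝ) • x) = 0 by
        rw [map_sub, map_smul, ker_apply_of_weight_two hE hx, show E x = 0 from hx]; simp,
        sub_smul_mem_range_pow_of_ker hE hW hx hxk⟩
    -- `H - k` is invertible on the span of the weights above `k`. So some `z` there has `(H - k) z
    -- = (H - k) x`, and `x - z` has weight exactly `k`.
    have key : ∀ y ∈ ⨆ m : ℕ, if k + 1 ≤ m then eigenspace H (m : ℝ) ⊓ LinearMap.ker E else ⊥,
        ∃ z ∈ (⨆ m : ℕ, if k ≤ m then eigenspace H (m : ℝ) ⊓ LinearMap.ker E else ⊥),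
          E z = 0 ∧ H z - (k : ℝ) • z = y := by
      intro y hy
      induction hy using Submodule.iSup_induction' with
      | mem m y hy =>
        split_ifs at hy with hm
        · have hne : (m - k : ℝ) ≠ 0 := by
            have : (k : ℝ) + 1 ≤ m := by exact_mod_cast hm
            linarith
          have hHy : H y = (m : ℝ) • y := mem_eigenspace_iff.1 hy.1
          refine ⟨(m - k : ℝ)⁻¹ • y, ?_, ?_, ?_⟩
          · refine Submodule.smul_mem _ _ (Submodule.mem_iSup_of_mem m ?_)
            rw [if_pos (by omega)]
            exact hy
          · rw [map_smul, show E y = 0 from hy.2, smul_zero]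
          · rw [map_smul, hHy, smul_comm (k : ℝ), ← smul_sub, ← sub_smul, smul_smul,
              inv_mul_cancel₀ hne, one_smul]
        · rw [Submodule.mem_bot] at hy
          exact ⟨0, Submodule.zero_mem _, by simp, by simp [hy]⟩
      | zero => exact ⟨0, Submodule.zero_mem _, by simp, by simp⟩
      | add y y' _ _ hy hy' =>
        obtain ⟨z, hz, hz1, hz2⟩ := hy
        obtain ⟨z', hz', hz1', hz2'⟩ := hy'
        refine ⟨z + z', Submodule.add_mem _ hz hz', by simp [hz1, hz1'], ?_⟩
        rw [← hz2, ← hz2', map_add]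
        module
    obtain ⟨z, hz, hz1, hz2⟩ := key _ h1
    have hxz : x - z ∈ ⨆ m : ℕ, if k ≤ m then eigenspace H (m : ℝ) ⊓ LinearMap.ker E else ⊥ := by
      refine Submodule.mem_iSup_of_mem k ?_
      rw [if_pos le_rfl]
      refine ⟨mem_eigenspace_iff.2 ?_, ?_⟩
      · rw [← sub_eq_zero, map_sub, smul_sub, sub_sub_sub_comm, hz2, sub_self]
      · show E (x - z) = 0
        rw [map_sub, hz1, sub_zero]
        exact hx
    simpa using Submodule.add_mem _ hxz hz

theorem ker_eq_iSup_eigenspace (hE : H * E = E * H + (2 : ℝ) • E)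
    (hW : E * W = W * E + H) (hnil : IsNilpotent E) {x : M} (hx : E x = 0) :
    ∃ u : ℕ →₀ M, (∀ m, H (u m) = (m : ℝ) • u m ∧ E (u m) = 0) ∧ (u.sum fun _ y => y) = x := by
  have h := ker_inf_range_pow_le_iSup hE hW hnil 0 (x := x) ⟨hx, x, by simp⟩
  simp only [zero_le, if_true] at h
  obtain ⟨u, hu, hux⟩ := (Submodule.mem_iSup_iff_exists_finsupp _ _).1 h
  exact ⟨u, fun m => ⟨mem_eigenspace_iff.1 (hu m).1, (hu m).2⟩, hux⟩

/-- On `ker E` the weights of `H` are nonnegative, so `H + c` with `c > 0` acts on each weight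
vector by a nonzero scalar. -/
theorem exists_add_smul_eq_of_ker (hE : H * E = E * H + (2 : ℝ) • E)
    (hW : E * W = W * E + H) (hnil : IsNilpotent E) {c : ℝ} (hc : 0 < c) {x : M} (hx : E x = 0) :
    ∃ z, E z = 0 ∧ H z + c • z = x := by
  obtain ⟨u, hu, rfl⟩ := ker_eq_iSup_eigenspace hE hW hnil hx
  refine ⟨∑ m ∈ u.support, ((m : ℝ) + c)⁻¹ • u m, ?_, ?_⟩
  · simp [map_sum, (hu _).2]
  · rw [map_sum, Finset.smul_sum, ← Finset.sum_add_distrib, Finsupp.sum]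
    refine Finset.sum_congr rfl fun m _ => ?_
    have : (m : ℝ) + c ≠ 0 := by positivity
    rw [map_smul, (hu m).1, smul_comm c, ← smul_add, ← add_smul, smul_smul, inv_mul_cancel₀ this,
      one_smul]

theorem eq_zero_of_ker_of_add_smul [FiniteDimensional ℝ M] (hE : H * E = E * H + (2 : ℝ) • E)
    (hW : E * W = W * E + H) (hnil : IsNilpotent E) {c : ℝ} (hc : 0 < c) {x : M} (hx : E x = 0)
    (h : H x + c • x = 0) : x = 0 := by
  have hst : ∀ y ∈ LinearMap.ker E, (H + c • (1 : End ℝ M)) y ∈ LinearMap.ker E := by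
    intro y hy
    show E (H y + c • y) = 0
    rw [map_add, map_smul, ker_apply_of_weight_two hE hy, show E y = 0 from hy]
    simp
  have hs : Function.Surjective ((H + c • (1 : End ℝ M)).restrict hst) := by
    rintro ⟨y, hy⟩
    obtain ⟨z, hz, hzy⟩ := exists_add_smul_eq_of_ker hE hW hnil hc (x := y) hy
    exact ⟨⟨z, hz⟩, Subtype.ext hzy⟩
  have hi := LinearMap.injective_iff_surjective.2 hs
  exact congrArg Subtype.val (@hi ⟨x, hx⟩ 0 (Subtype.ext (by simpa using h)))

/-- A nonzero eigenvector of a commutator `[H, -]` for a nonzero eigenvalue is nilpotent. -/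
theorem isNilpotent_of_commutator_eq_smul [FiniteDimensional ℝ M] {F : End ℝ M} {c : ℝ}
    (hc : c ≠ 0) (h : H * F = F * H + c • F) : IsNilpotent F := by
  by_contra hF
  have hpow : ∀ k : ℕ, H * F ^ k = F ^ k * H + (k * c) • F ^ k := by
    intro k
    induction k with
    | zero => simp
    | succ k ih =>
      rw [pow_succ, ← mul_assoc, ih, add_mul, mul_assoc, h, mul_add, smul_mul_assoc,
        mul_smul_comm, ← mul_assoc, add_assoc, ← add_smul]
      push_cast
      ring_nf
  -- If no power of `F` vanished, the powers `F ^ k` would be eigenvectors of `[H, -]` for the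
  -- infinitely many eigenvalues `k c`.
  let D : End ℝ (End ℝ M) := LinearMap.mulLeft ℝ H - LinearMap.mulRight ℝ H
  have hD : ∀ k : ℕ, D.HasEigenvalue (k * c) := by
    intro k
    refine hasEigenvalue_of_hasEigenvector (x := F ^ k)
      (hasEigenvector_iff.2 ⟨mem_eigenspace_iff.2 ?_, fun h0 => hF ⟨k, h0⟩⟩)
    simp [D, hpow k]
  have hinj : Function.Injective fun k : ℕ => (k : ℝ) * c := fun a b hab => by
    simpa [hc] using hab
  exact (Set.infinite_range_of_injective hinj)
    ((finite_hasEigenvalue D).subset (by rintro _ ⟨k, rfl⟩; exact hD k))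

variable {F : End ℝ M}

/-- With `E` and `F` exchanged and `H` negated, `-H` has nonnegative weights on `ker F`, so `-H + (k
+ 2)` is injective there. It maps `ker F ∩ range (E ^ (k + 1))` into `S = ker F ∩ range (E ^ (k +
2))` and is bijective on `S`, so the two intersections agree. Iterating reaches `E ^ N = 0`. -/
theorem ker_lowering_inf_range_raising [FiniteDimensional ℝ M]
    (hE : H * E = E * H + (2 : ℝ) • E) (hF : H * F = F * H + (-2 : ℝ) • F)
    (hEF : E * F = F * E + H) : LinearMap.ker F ⊓ LinearMap.range E = ⊥ := by
  have hEn : IsNilpotent E := isNilpotent_of_commutator_eq_smul two_ne_zero hE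
  have hFn : IsNilpotent F := isNilpotent_of_commutator_eq_smul (by norm_num) hF
  have hF' : (-H) * F = F * (-H) + (2 : ℝ) • F := by
    rw [neg_mul, hF, mul_neg]; module
  have hFE : F * E = E * F + (-H) := by rw [hEF]; abel
  have step : ∀ k : ℕ, LinearMap.ker F ⊓ LinearMap.range (E ^ (k + 1)) ≤
      LinearMap.ker F ⊓ LinearMap.range (E ^ (k + 2)) := by
    intro k
    set S := LinearMap.ker F ⊓ LinearMap.range (E ^ (k + 2)) with hS
    have hst : ∀ y ∈ S, (-H + (k + 2 : ℝ) • (1 : End ℝ M)) y ∈ S := by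
      rintro y ⟨hy, z, rfl⟩
      refine ⟨?_, ?_⟩
      · show F (-H ((E ^ (k + 2)) z) + (k + 2 : ℝ) • ((E ^ (k + 2)) z)) = 0
        have := ker_apply_of_weight_two hF' (x := (E ^ (k + 2)) z) hy
        rw [LinearMap.neg_apply] at this
        rw [map_add, map_smul, this, show F ((E ^ (k + 2)) z) = 0 from hy]
        simp
      · refine Submodule.add_mem _ ?_ (Submodule.smul_mem _ _ ⟨z, rfl⟩)
        have := congrArg (fun T : End ℝ M => T z) (pow_semiconj_of_weight_two hE (k + 2))
        simp only [Module.End.mul_apply, LinearMap.add_apply, LinearMap.smul_apply] at this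
        rw [LinearMap.neg_apply, this, ← map_smul, ← map_add, ← map_neg]
        exact ⟨_, rfl⟩
    have hinj : ∀ y : M, F y = 0 → (-H + (k + 2 : ℝ) • (1 : End ℝ M)) y = 0 → y = 0 :=
      fun y hy hy' => eq_zero_of_ker_of_add_smul hF' hFE hFn (by positivity) hy hy'
    have hsurj : Function.Surjective ((-H + (k + 2 : ℝ) • (1 : End ℝ M)).restrict hst) := by
      refine LinearMap.injective_iff_surjective.1 ((injective_iff_map_eq_zero _).2 ?_)
      rintro ⟨y, hy⟩ h0
      exact Subtype.ext (hinj y hy.1 (congrArg Subtype.val h0))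
    rintro x ⟨hx, y, rfl⟩
    set x := (E ^ (k + 1)) y with hxdef
    have hmem : (-H + (k + 2 : ℝ) • (1 : End ℝ M)) x ∈ S := by
      refine ⟨?_, ?_⟩
      · show F (-H x + (k + 2 : ℝ) • x) = 0
        have := ker_apply_of_weight_two hF' (x := x) hx
        rw [LinearMap.neg_apply] at this
        rw [map_add, map_smul, this, show F x = 0 from hx]
        simp
      · have h := congrArg (fun T : End ℝ M => T y) (pow_succ_mul_lowering hE hEF k)
        simp only [LinearMap.add_apply, Module.End.mul_apply, LinearMap.smul_apply,
          LinearMap.sub_apply, ← hxdef, show F x = 0 from hx, zero_add] at h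
        have h2 : (E ^ (k + 2)) (F y) = (k + 1 : ℝ) • (H x - (k + 2 : ℝ) • x) := by
          have hEH := congrArg (fun T : End ℝ M => T ((E ^ k) y)) hE
          simp only [Module.End.mul_apply, LinearMap.add_apply, LinearMap.smul_apply] at hEH
          have hEk : E ((E ^ k) y) = x := by rw [hxdef, pow_succ']; rfl
          rw [hEk] at hEH
          rw [show k + 2 = (k + 1) + 1 from rfl, pow_succ', Module.End.mul_apply, h, map_smul,
            map_sub, map_smul, hEk, hEH]
          module
        have hk : (k + 1 : ℝ) ≠ 0 := by positivity
        refine ⟨-((k + 1 : ℝ)⁻¹ • F y), ?_⟩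
        rw [map_neg, map_smul, h2, smul_smul, inv_mul_cancel₀ hk, one_smul]
        simp only [LinearMap.add_apply, LinearMap.neg_apply, LinearMap.smul_apply,
          Module.End.one_apply]
        abel
    obtain ⟨⟨z, hz⟩, hzx⟩ := hsurj ⟨_, hmem⟩
    have hzx' : (-H + (k + 2 : ℝ) • (1 : End ℝ M)) z = (-H + (k + 2 : ℝ) • (1 : End ℝ M)) x :=
      congrArg Subtype.val hzx
    have : z - x = 0 := hinj _ (by rw [map_sub, show F z = 0 from hz.1, show F x = 0 from hx,
      sub_zero]) (by rw [map_sub, hzx', sub_self])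
    rw [← sub_eq_zero.1 this]
    exact hz
  obtain ⟨N, hN⟩ := hEn
  have : ∀ k : ℕ, LinearMap.ker F ⊓ LinearMap.range E ≤
      LinearMap.ker F ⊓ LinearMap.range (E ^ (k + 1)) := by
    intro k
    induction k with
    | zero => simp
    | succ k ih => exact ih.trans (step k)
  refine eq_bot_iff.2 ((this N).trans ?_)
  rw [pow_succ, hN]
  simp

/-- Both `ker F ∩ range E` and `ker E ∩ range F` vanish, and by rank–nullity the four dimensions add
up to `2 dim M`. Hence both sums are the whole space. -/
theorem isCompl_ker_lowering_range_raising [FiniteDimensional ℝ M]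
    (hE : H * E = E * H + (2 : ℝ) • E) (hF : H * F = F * H + (-2 : ℝ) • F)
    (hEF : E * F = F * E + H) : IsCompl (LinearMap.ker F) (LinearMap.range E) := by
  have h1 := ker_lowering_inf_range_raising hE hF hEF
  have h2 : LinearMap.ker E ⊓ LinearMap.range F = ⊥ :=
    ker_lowering_inf_range_raising (H := -H) (E := F) (F := E)
      (by rw [neg_mul, hF, mul_neg]; module) (by rw [neg_mul, hE, mul_neg]; module)
      (by rw [hEF]; abel)
  refine ⟨disjoint_iff.2 h1, codisjoint_iff.2 (Submodule.eq_top_of_finrank_eq ?_)⟩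
  have d1 := Submodule.finrank_sup_add_finrank_inf_eq (LinearMap.ker F) (LinearMap.range E)
  have d2 := Submodule.finrank_sup_add_finrank_inf_eq (LinearMap.ker E) (LinearMap.range F)
  rw [h1, finrank_bot] at d1
  rw [h2, finrank_bot] at d2
  have e1 := LinearMap.finrank_range_add_finrank_ker E
  have e2 := LinearMap.finrank_range_add_finrank_ker F
  have l1 := Submodule.finrank_le (LinearMap.ker F ⊔ LinearMap.range E)
  have l2 := Submodule.finrank_le (LinearMap.ker E ⊔ LinearMap.range F)
  omega

end Operators

/-! ### Nilpotent elements of a Lie algebra with nondegenerate Killing form -/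

section Jacobson

open Module

variable {M : Type*} [AddCommGroup M] [Module ℝ M]

/-- **Jacobson's lemma**: if `A` is nilpotent and commutes with `C = [A, B]`, then `C` is
nilpotent. -/
theorem isNilpotent_commutator {A B C : End ℝ M} (hA : IsNilpotent A) (hC : A * B = B * A + C)
    (hAC : A * C = C * A) : IsNilpotent C := by
  let D : End ℝ (End ℝ M) := LinearMap.mulLeft ℝ A - LinearMap.mulRight ℝ A
  have hDapp : ∀ T, D T = A * T - T * A := fun T => rfl
  have hD : IsNilpotent D := by
    refine Commute.isNilpotent_sub (LinearMap.commute_mulLeft_right A A) ?_ ?_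
    · obtain ⟨N, hN⟩ := hA
      exact ⟨N, by rw [LinearMap.pow_mulLeft, hN, LinearMap.mulLeft_zero_eq_zero]⟩
    · obtain ⟨N, hN⟩ := hA
      exact ⟨N, by rw [LinearMap.pow_mulRight, hN, LinearMap.mulRight_zero_eq_zero]⟩
  have hDC : ∀ T, D (C * T) = C * D T := by
    intro T
    simp only [hDapp, mul_sub, ← mul_assoc, hAC]
  have hDB : ∀ T, D (B * T) = B * D T + C * T := by
    intro T
    simp only [hDapp, mul_sub, ← mul_assoc, hC, add_mul]
    abel
  have leib : ∀ (m : ℕ) T, (D ^ (m + 1)) (B * T) =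
      B * (D ^ (m + 1)) T + (m + 1 : ℝ) • (C * (D ^ m) T) := by
    intro m T
    induction m with
    | zero => simp [hDB]
    | succ m ih =>
      rw [pow_succ' D (m + 1), Module.End.mul_apply, ih, map_add, map_smul, hDB, hDC,
        ← Module.End.mul_apply D (D ^ m) T, ← pow_succ', ← Module.End.mul_apply D (D ^ (m + 1)) T,
        ← pow_succ']
      push_cast
      module
  -- `D = [A, -]` is a derivation sending `B` to `C` and killing `C`, so its `k`-th power on `B ^ k`
  -- gives `k! C ^ k`. Nilpotency of `D` passes to `C`.
  have main : ∀ k : ℕ, (D ^ (k + 1)) (B ^ k) = 0 ∧ (D ^ k) (B ^ k) = (k.factorial : ℝ) • C ^ k := by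
    intro k
    induction k with
    | zero => simp [hDapp]
    | succ k ih =>
      have h2 : (D ^ (k + 2)) (B ^ k) = 0 := by
        rw [pow_succ', Module.End.mul_apply, ih.1, map_zero]
      refine ⟨?_, ?_⟩
      · rw [pow_succ' B, leib, ih.1, h2]
        simp
      · rw [pow_succ' B, leib, ih.1, ih.2, Nat.factorial_succ, pow_succ']
        rw [mul_zero, zero_add, mul_smul_comm, smul_smul]
        push_cast
        rfl
  obtain ⟨N, hN⟩ := hD
  refine ⟨N, ?_⟩
  have := (main N).2
  rw [hN, LinearMap.zero_apply] at this
  exact (smul_eq_zero.1 this.symm).resolve_left (by exact_mod_cast N.factorial_ne_zero)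

/-- Filter by the kernels of the powers of `A`: on `ker A ^ (k + 1)` one has `A ^ k (A B) = (k + 1)
C A ^ k`, so a power of `A B` that kills `C` moves each step of the filtration into the previous
one. -/
theorem isNilpotent_mul_of_commutator {A B C : End ℝ M} (hA : IsNilpotent A)
    (hC : A * B = B * A + C) (hAC : A * C = C * A) : IsNilpotent (A * B) := by
  have hCn := isNilpotent_commutator hA hC hAC
  have hpow : ∀ k : ℕ, A ^ k * (A * B) = (A * B + (k : ℝ) • C) * A ^ k := by
    intro k
    induction k with
    | zero => simp
    | succ k ih =>
      have h1 : A * (A * B) = (A * B + C) * A := by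
        rw [add_mul, ← hAC, mul_assoc A B A, ← mul_add, ← hC]
      rw [pow_succ', mul_assoc, ih, ← mul_assoc, mul_add, h1, mul_smul_comm, hAC,
        ← smul_mul_assoc, ← add_mul, mul_assoc]
      congr 1
      push_cast
      module
  have hker : ∀ (k : ℕ) (x : M), (A ^ (k + 1)) x = 0 →
      (A ^ k) ((A * B) x) = (k + 1 : ℝ) • C ((A ^ k) x) := by
    intro k x hx
    have h1 : A ((A ^ k) x) = 0 := by rw [← Module.End.mul_apply, ← pow_succ', hx]
    have h2 := congrArg (fun T : End ℝ M => T ((A ^ k) x)) hC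
    have h3 := congrArg (fun T : End ℝ M => T x) (hpow k)
    simp only [Module.End.mul_apply, LinearMap.add_apply, LinearMap.smul_apply, h1, map_zero,
      zero_add] at h2 h3 ⊢
    rw [h3, h2]
    module
  obtain ⟨N, hN⟩ := hCn
  obtain ⟨r, hr⟩ := hA
  have hiter : ∀ (k m : ℕ) (x : M), (A ^ (k + 1)) x = 0 →
      (A ^ (k + 1)) (((A * B) ^ m) x) = 0 ∧
      (A ^ k) (((A * B) ^ m) x) = (k + 1 : ℝ) ^ m • (C ^ m) ((A ^ k) x) := by
    intro k m x hx
    induction m with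
    | zero => simpa using hx
    | succ m ih =>
      have h1 := hker k _ ih.1
      rw [pow_succ' (A * B), Module.End.mul_apply]
      refine ⟨?_, ?_⟩
      · rw [pow_succ', Module.End.mul_apply, h1, map_smul, ← Module.End.mul_apply A, hAC,
          Module.End.mul_apply, ← Module.End.mul_apply A, ← pow_succ', ih.1]
        simp
      · rw [h1, ih.2, map_smul, smul_smul, ← Module.End.mul_apply C, ← pow_succ', ← pow_succ']
  have hdesc : ∀ (k : ℕ) (x : M), (A ^ k) x = 0 → (((A * B) ^ (N * k)) x) = 0 := by
    intro k
    induction k with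
    | zero => intro x hx; simpa using hx
    | succ k ih =>
      intro x hx
      have h1 := (hiter k N x hx).2
      rw [hN, LinearMap.zero_apply, smul_zero] at h1
      rw [Nat.mul_succ, pow_add, Module.End.mul_apply]
      exact ih _ h1
  exact ⟨N * r, LinearMap.ext fun x => hdesc r x (by rw [hr]; rfl)⟩

end Jacobson

/-! ### The Jacobson–Morozov theorem and rank growth on the transverse slice -/

section Morozov

open Module LieAlgebra

variable {L : Type*} [LieRing L] [LieAlgebra ℝ L]

theorem killingForm_ad_apply (e x y : L) :
    killingForm ℝ L (ad ℝ L e x) y = killingForm ℝ L x ((-ad ℝ L e) y) := by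
  have := LieModule.traceForm_apply_lie_apply ℝ L L x e y
  rw [LinearMap.neg_apply, ad_apply, ad_apply, map_neg, ← this, ← lie_skew, map_neg,
    LinearMap.neg_apply]

theorem ad_mul_ad_eq (x y : L) : ad ℝ L x * ad ℝ L y = ad ℝ L y * ad ℝ L x + ad ℝ L ⁅x, y⁆ := by
  ext z
  simp

variable [FiniteDimensional ℝ L]

theorem isCompl_ker_ad_range_ad {e h f : L} (he : ⁅h, e⁆ = (2 : ℝ) • e)
    (hf : ⁅h, f⁆ = (-2 : ℝ) • f) (hef : ⁅e, f⁆ = h) :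
    IsCompl (LinearMap.ker (ad ℝ L f)) (LinearMap.range (ad ℝ L e)) :=
  isCompl_ker_lowering_range_raising (H := ad ℝ L h)
    (by rw [ad_mul_ad_eq, he, map_smul]) (by rw [ad_mul_ad_eq, hf, map_smul])
    (by rw [ad_mul_ad_eq, hef])

theorem exists_weight_decomposition {e h f : L} (hf : ⁅h, f⁆ = (-2 : ℝ) • f)
    (hef : ⁅e, f⁆ = h) {v : L} (hv : ⁅f, v⁆ = 0) :
    ∃ u : ℕ →₀ L, (∀ m, ⁅h, u m⁆ = -(m : ℝ) • u m ∧ ⁅f, u m⁆ = 0) ∧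
      (u.sum fun _ y => y) = v := by
  have hF : ad ℝ L (-h) * ad ℝ L f = ad ℝ L f * ad ℝ L (-h) + (2 : ℝ) • ad ℝ L f := by
    rw [ad_mul_ad_eq, neg_lie, hf, ← map_smul, neg_smul, neg_neg]
  obtain ⟨u, hu, huv⟩ := ker_eq_iSup_eigenspace hF (W := ad ℝ L e)
    (by rw [ad_mul_ad_eq, ← lie_skew, hef])
    (isNilpotent_of_commutator_eq_smul two_ne_zero hF) (x := v) hv
  refine ⟨u, fun m => ⟨?_, (hu m).2⟩, huv⟩
  have := (hu m).1
  rw [ad_apply, neg_lie] at this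
  rw [neg_smul, ← this, neg_neg]

variable [IsKilling ℝ L]

/-- For the nondegenerate Killing form, the range of `T` is the orthogonal complement of the kernel
of its adjoint `T'`. -/
theorem mem_range_of_killingForm {T T' : End ℝ L}
    (hT : ∀ x y, killingForm ℝ L (T x) y = killingForm ℝ L x (T' y)) {y : L}
    (hy : ∀ z, T' z = 0 → killingForm ℝ L y z = 0) : ∃ w, T w = y := by
  have hnd := IsKilling.killingForm_nondegenerate ℝ L
  have h := LinearMap.BilinForm.orthogonal_orthogonal hnd (LieModule.traceForm_isSymm ℝ L L).isRefl (LinearMap.range T)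
  suffices y ∈ LinearMap.range T from this
  rw [← h, LinearMap.BilinForm.mem_orthogonal_iff]
  intro z hz
  rw [LinearMap.BilinForm.mem_orthogonal_iff] at hz
  have hz' : T' z = 0 := by
    refine hnd.2 _ fun x => ?_
    rw [← hT]
    exact hz (T x) ⟨x, rfl⟩
  show killingForm ℝ L z y = 0
  rw [LieModule.traceForm_comm]
  exact hy z hz'

/-- A nilpotent element lies in the image of its adjoint action. -/
theorem IsNilpotentElt.exists_lie_eq {e : L} (he : IsNilpotentElt e) : ∃ y, ⁅e, y⁆ = e := by
  -- If `[e, z] = 0` then `ad e` and `ad z` commute, so their product is nilpotent and has trace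
  -- zero: `e` is orthogonal to `ker (ad e)`.
  obtain ⟨w, hw⟩ := mem_range_of_killingForm (killingForm_ad_apply e) (y := e) fun z hz => by
    have hez : ⁅e, z⁆ = 0 := neg_eq_zero.1 hz
    rw [killingForm_apply_apply]
    refine (LinearMap.isNilpotent_trace_of_isNilpotent ?_).eq_zero
    refine Commute.isNilpotent_mul_right ?_ he
    rw [commute_iff_eq, ad_mul_ad_eq, hez]
    simp
  exact ⟨w, hw⟩

/-- **Jacobson–Morozov**: a nilpotent element `e` is part of a triple satisfying the relations
of `sl₂`. -/
theorem IsNilpotentElt.exists_triple {e : L} (he : IsNilpotentElt e) :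
    ∃ h f : L, ⁅h, e⁆ = (2 : ℝ) • e ∧ ⁅h, f⁆ = (-2 : ℝ) • f ∧ ⁅e, f⁆ = h := by
  set E := ad ℝ L e with hEdef
  -- `(ad e)²` is self-adjoint, and `e` is orthogonal to its kernel by
  -- `isNilpotent_mul_of_commutator`. The factor `-2` normalises `[h, e] = 2 e`.
  obtain ⟨w, hw⟩ := mem_range_of_killingForm (T := E * E) (T' := E * E) (y := (-2 : ℝ) • e)
    (fun x y => by
      rw [Module.End.mul_apply, killingForm_ad_apply, killingForm_ad_apply, Module.End.mul_apply,
        LinearMap.neg_apply, LinearMap.neg_apply, map_neg, map_neg, map_neg, neg_neg])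
    (fun z hz => by
      have hez : ⁅e, ⁅e, z⁆⁆ = 0 := hz
      rw [map_smul, LinearMap.smul_apply, killingForm_apply_apply]
      have : IsNilpotent (ad ℝ L e * ad ℝ L z) :=
        isNilpotent_mul_of_commutator he (ad_mul_ad_eq e z) (by rw [ad_mul_ad_eq, hez]; simp)
      rw [show ad ℝ L e ∘ₗ ad ℝ L z = ad ℝ L e * ad ℝ L z from rfl,
        (LinearMap.isNilpotent_trace_of_isNilpotent this).eq_zero, smul_zero])
  have hw' : ⁅e, ⁅e, w⁆⁆ = (-2 : ℝ) • e := hw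
  set h := ⁅e, w⁆ with hh
  have hhe : ⁅h, e⁆ = (2 : ℝ) • e := by
    rw [← lie_skew, hw']; module
  have hE : ad ℝ L h * E = E * ad ℝ L h + (2 : ℝ) • E := by
    rw [hEdef, ad_mul_ad_eq, hhe, map_smul]
  have hW : E * ad ℝ L w = ad ℝ L w * E + ad ℝ L h := ad_mul_ad_eq e w
  -- The defect of `w` from having weight `-2` lies in `ker (ad e)`, where `ad h + 2` is surjective.
  -- Hence `w` can be corrected by some `z` centralizing `e`, which leaves `h = [e, w]` unchanged.
  have hx : E (⁅h, w⁆ + (2 : ℝ) • w) = 0 := by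
    show ⁅e, ⁅h, w⁆ + (2 : ℝ) • w⁆ = 0
    rw [lie_add, lie_smul, leibniz_lie, hw', smul_lie, ← hh, lie_self]
    module
  obtain ⟨z, hz, hzx⟩ := exists_add_smul_eq_of_ker hE hW he two_pos hx
  have hez : ⁅e, z⁆ = 0 := hz
  rw [ad_apply] at hzx
  refine ⟨h, w - z, hhe, ?_, by rw [lie_sub, hez, sub_zero]⟩
  rw [lie_sub, ← sub_eq_zero]
  have : ⁅h, w⁆ + (2 : ℝ) • w - (⁅h, z⁆ + (2 : ℝ) • z) = 0 := by rw [hzx, sub_self]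
  rw [← this]
  module

/-- A nonzero element of the slice `ker (ad f)` increases the rank of `ad`, as long as
transversality is kept. -/
theorem finrank_range_ad_lt {e h f : L} (he : ⁅h, e⁆ = (2 : ℝ) • e)
    (hf : ⁅h, f⁆ = (-2 : ℝ) • f) (hef : ⁅e, f⁆ = h) {v : L} (hv : ⁅f, v⁆ = 0) (hv0 : v ≠ 0)
    (hn : IsNilpotentElt (e + v))
    (htop : LinearMap.ker (ad ℝ L f) ⊔ LinearMap.range (ad ℝ L (e + v)) = ⊤) :
    finrank ℝ (LinearMap.range (ad ℝ L e)) < finrank ℝ (LinearMap.range (ad ℝ L (e + v))) := by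
  set V := LinearMap.ker (ad ℝ L f)
  have hc := isCompl_ker_ad_range_ad he hf hef
  have d1 : finrank ℝ V + _ = _ := Submodule.finrank_add_eq_of_isCompl hc
  have d2 := Submodule.finrank_sup_add_finrank_inf_eq V (LinearMap.range (ad ℝ L (e + v)))
  rw [htop, finrank_top] at d2
  have hF : ad ℝ L (-h) * ad ℝ L f = ad ℝ L f * ad ℝ L (-h) + (2 : ℝ) • ad ℝ L f := by
    rw [ad_mul_ad_eq, neg_lie, hf, ← map_smul, neg_smul, neg_neg]
  -- On `ker (ad f)` the weights of `h` are nonpositive, so `2 - ad h` is injective. A nonzero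
  -- vector in `V ∩ range (ad (e + v))` forces the rank above the complementary dimension.
  have hne : (2 : ℝ) • v - ⁅h, v⁆ ≠ 0 := by
    intro h0
    refine hv0 (eq_zero_of_ker_of_add_smul hF (W := ad ℝ L e)
      (by rw [ad_mul_ad_eq, ← lie_skew, hef])
      (isNilpotent_of_commutator_eq_smul two_ne_zero hF) two_pos (x := v) hv ?_)
    rw [ad_apply, neg_lie, ← h0]
    abel
  have hmem : (2 : ℝ) • v - ⁅h, v⁆ ∈ V ⊓ LinearMap.range (ad ℝ L (e + v)) := by
    refine ⟨?_, ?_⟩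
    · show ⁅f, (2 : ℝ) • v - ⁅h, v⁆⁆ = 0
      rw [lie_sub, lie_smul, leibniz_lie, hv, ← lie_skew f h, hf]
      simp [hv]
    · obtain ⟨y, hy⟩ := hn.exists_lie_eq
      -- Here `[e + v, y] = e + v` and `[e + v, h] = -2 e - [h, v]`, so the multiples of `e` cancel.
      refine ⟨(2 : ℝ) • y + h, ?_⟩
      rw [ad_apply, lie_add, lie_smul, hy, ← lie_skew (e + v) h, lie_add, he]
      module
  have hpos : 0 < finrank ℝ (V ⊓ LinearMap.range (ad ℝ L (e + v)) : Submodule ℝ L) := by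
    refine Module.finrank_pos_iff_exists_ne_zero.2 ⟨⟨_, hmem⟩, fun h0 => hne ?_⟩
    exact congrArg Subtype.val h0
  omega

end Morozov

/-- Cartan's criterion for simple Lie algebras. -/
theorem isKilling_of_isSimple (L : Type*) [LieRing L] [LieAlgebra ℝ L] [FiniteDimensional ℝ L]
    [LieAlgebra.IsSimple ℝ L] : LieAlgebra.IsKilling ℝ L := inferInstance

/-! ### Semisimple elements and gradings adapted to a Jordan decomposition -/

section Semisimple

open Module LieAlgebra
open scoped TensorProduct

variable {L : Type*} [LieRing L] [LieAlgebra ℝ L] [FiniteDimensional ℝ L]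

/-- Diagonalizability makes kernel and range of the complexified `ad s` span, hence by dimension
meet in zero; this descends because `L` embeds in its complexification. -/
theorem IsSemisimpleElt.lie_eq_zero_of_lie_lie {s : L} (hs : IsSemisimpleElt s) {y : L}
    (hy : ⁅s, ⁅s, y⁆⁆ = 0) : ⁅s, y⁆ = 0 := by
  set D := ad ℝ L s
  let DC : Module.End ℂ (TensorProduct ℝ ℂ L) := D.baseChange ℂ
  have hinj : Function.Injective fun z : L => (1 : ℂ) ⊗ₜ[ℝ] z :=
    Module.FaithfullyFlat.tensorProduct_mk_injective (A := ℝ) (B := ℂ) L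
  have htop : LinearMap.ker DC ⊔ LinearMap.range DC = ⊤ := by
    refine eq_top_iff.2 (hs.symm.le.trans (iSup_le fun μ y hy => ?_))
    have hy' : DC y = μ • y := Module.End.mem_eigenspace_iff.1 hy
    rcases eq_or_ne μ 0 with rfl | hμ
    · exact Submodule.mem_sup_left (by rw [LinearMap.mem_ker, hy', zero_smul])
    · refine Submodule.mem_sup_right ⟨μ⁻¹ • y, ?_⟩
      rw [map_smul, hy', smul_smul, inv_mul_cancel₀ hμ, one_smul]
  have hdim := Submodule.finrank_sup_add_finrank_inf_eq (LinearMap.ker DC) (LinearMap.range DC)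
  have hdim' := LinearMap.finrank_range_add_finrank_ker DC
  rw [htop, finrank_top] at hdim
  have hbot : LinearMap.ker DC ⊓ LinearMap.range DC = ⊥ :=
    Submodule.finrank_eq_zero.1 (by omega)
  have happ : ∀ z, DC ((1 : ℂ) ⊗ₜ[ℝ] z) = (1 : ℂ) ⊗ₜ[ℝ] ⁅s, z⁆ := fun z =>
    LinearMap.baseChange_tmul ..
  have hmem : (1 : ℂ) ⊗ₜ[ℝ] ⁅s, y⁆ ∈ LinearMap.ker DC ⊓ LinearMap.range DC :=
    ⟨by rw [SetLike.mem_coe, LinearMap.mem_ker, happ, hy, TensorProduct.tmul_zero], _, happ y⟩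
  rw [hbot, Submodule.mem_bot] at hmem
  exact hinj (hmem.trans (TensorProduct.tmul_zero _ _).symm)

/-- Start from `[e, y] = e` and split `y` along `L = ker (ad s) ⊕ range (ad s)`. Since `ad e`
commutes with `ad s` it preserves both summands, and `e` lies in the first, so the first component
`y0` already satisfies `[e, y0] = e`. Take `h = -y0`. -/
theorem IsJordanDecomposition.exists_grading [IsKilling ℝ L] {x s e : L}
    (hx : IsJordanDecomposition x s e) : ∃ h : L, ⁅h, s⁆ = 0 ∧ ⁅h, e⁆ = e := by
  obtain ⟨y, hy⟩ := hx.nilpotent.exists_lie_eq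
  set D := ad ℝ L s
  have hdisj : Disjoint (LinearMap.ker D) (LinearMap.range D) := by
    rw [Submodule.disjoint_def]
    rintro _ h1 ⟨z, rfl⟩
    exact hx.semisimple.lie_eq_zero_of_lie_lie h1
  have hcompl : LinearMap.ker D ⊔ LinearMap.range D = ⊤ := by
    refine Submodule.eq_top_of_disjoint _ _ ?_ hdisj
    rw [add_comm, LinearMap.finrank_range_add_finrank_ker]
  obtain ⟨y0, hy0, _, ⟨w, rfl⟩, hyw⟩ :=
    Submodule.mem_sup.1 (hcompl ▸ Submodule.mem_top (x := y))
  have hs0 : ⁅s, y0⁆ = 0 := hy0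
  refine ⟨-y0, by rw [neg_lie, lie_skew, hs0], ?_⟩
  have hz : e - ⁅e, y0⁆ = D ⁅e, w⁆ := by
    nth_rewrite 1 [← hy]
    rw [← hyw, lie_add, ad_apply, ad_apply, leibniz_lie s e w, hx.commute]
    simp
  have h0 : D (e - ⁅e, y0⁆) = 0 := by
    rw [map_sub, ad_apply, ad_apply, leibniz_lie s e y0, hx.commute, hs0]
    simp
  have := Submodule.disjoint_def.1 hdisj _ h0 ⟨_, hz.symm⟩
  rw [neg_lie, lie_skew, ← sub_eq_zero.1 this]

end Semisimple

/-! ### Exponential conjugation in a Banach algebra -/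

section Conjugation

variable {A : Type*} [NormedRing A] [NormedAlgebra ℝ A] [CompleteSpace A]

theorem exp_mul_exp_neg (X : A) : NormedSpace.exp X * NormedSpace.exp (-X) = 1 := by
  let _ : NormedAlgebra ℚ A := NormedAlgebra.restrictScalars ℚ ℝ A
  rw [← NormedSpace.exp_add_of_commute (Commute.neg_right rfl), add_neg_cancel,
    NormedSpace.exp_zero]

/-- The relation says `H Y = Y (H + c)`; exponentiating it splits off the central factor `exp (t
c)`. -/
theorem exp_smul_mul_of_lie_eq_smul {H Y : A} {c : ℝ} (h : H * Y - Y * H = c • Y) (t : ℝ) :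
    NormedSpace.exp (t • H) * Y = Real.exp (t * c) • (Y * NormedSpace.exp (t • H)) := by
  let _ : NormedAlgebra ℚ A := NormedAlgebra.restrictScalars ℚ ℝ A
  have h1 : SemiconjBy Y (t • H + algebraMap ℝ A (t * c)) (t • H) := by
    rw [SemiconjBy, mul_add, Algebra.algebraMap_eq_smul_one, mul_smul_comm, mul_smul_comm, mul_one,
      smul_mul_assoc, mul_smul, ← h, ← smul_add]
    congr 1
    abel
  have h2 := h1.exp_right
  rw [SemiconjBy, NormedSpace.exp_add_of_commute (Algebra.commute_algebraMap_right _ _),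
    ← NormedSpace.algebraMap_exp_comm, Algebra.algebraMap_eq_smul_one, mul_smul_comm, mul_one,
    mul_smul_comm, ← Real.exp_eq_exp_ℝ] at h2
  exact h2.symm

/-- Local surjectivity theorem for `(X, v) ↦ exp X (e + v) exp (-X)`, whose derivative at the origin
is `(X, v) ↦ [X, e] + v`. The map takes values in `A`, so it is composed with a linear retraction
`P` onto `S`; as its values lie in `S`, this changes nothing. -/
theorem eventually_exists_conj_exp [FiniteDimensional ℝ A] (S V : Submodule ℝ A) (hVS : V ≤ S)
    (hS : ∀ X ∈ S, ∀ Y ∈ S, NormedSpace.exp X * Y * NormedSpace.exp (-X) ∈ S) (e : S)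
    (hspan : ∀ y ∈ S, ∃ X ∈ S, ∃ v ∈ V, X * e - e * X + v = y) {U : Set A} (hU : U ∈ 𝓝 0) :
    ∀ᶠ y : S in 𝓝 e, ∃ X ∈ S, ∃ v ∈ V, v ∈ U ∧
      NormedSpace.exp X * (e + v) * NormedSpace.exp (-X) = y := by
  obtain ⟨P₀, hP₀⟩ := LinearMap.exists_leftInverse_of_injective S.subtype S.ker_subtype
  let P : A →L[ℝ] S := P₀.toContinuousLinearMap
  have hP : ∀ x : S, P x = x := fun x => LinearMap.congr_fun hP₀ x
  let i₁ : S × V →L[ℝ] A := S.subtypeL.comp (ContinuousLinearMap.fst ℝ S V)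
  let i₂ : S × V →L[ℝ] A := V.subtypeL.comp (ContinuousLinearMap.snd ℝ S V)
  let f : S × V → A := fun p =>
    NormedSpace.exp (i₁ p) * ((e : A) + i₂ p) * NormedSpace.exp (-i₁ p)
  have hexp : HasStrictFDerivAt (NormedSpace.exp : A → A) (1 : A →L[ℝ] A) 0 :=
    hasStrictFDerivAt_exp_zero
  have d1 : HasStrictFDerivAt (fun p => NormedSpace.exp (i₁ p)) i₁ (0 : S × V) := by
    have h0 : HasStrictFDerivAt (NormedSpace.exp : A → A) (1 : A →L[ℝ] A) (i₁ 0) := by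
      rw [map_zero]; exact hexp
    exact h0.comp (0 : S × V) i₁.hasStrictFDerivAt
  have d2 : HasStrictFDerivAt (fun p => NormedSpace.exp (-i₁ p)) (-i₁) (0 : S × V) := by
    have h0 : HasStrictFDerivAt (NormedSpace.exp : A → A) (1 : A →L[ℝ] A) ((-i₁) 0) := by
      rw [map_zero]; exact hexp
    exact h0.comp (0 : S × V) (-i₁).hasStrictFDerivAt
  have d3 : HasStrictFDerivAt (fun p => (e : A) + i₂ p) i₂ (0 : S × V) :=
    i₂.hasStrictFDerivAt.const_add _
  have d4 := P.hasStrictFDerivAt.comp (0 : S × V) ((d1.mul' d3).mul' d2)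
  have hf0 : P (f 0) = e := by simp [f, hP]
  have hsurj := d4.map_nhds_eq_of_surj ?_
  · have hmem : {p : S × V | i₂ p ∈ U} ∈ 𝓝 (0 : S × V) := by
      refine i₂.continuous.continuousAt.preimage_mem_nhds ?_
      rwa [map_zero]
    have him := image_mem_map (m := fun p => P (f p)) hmem
    have hmap : map (fun p => P (f p)) (𝓝 0) = 𝓝 e := by
      rw [← hf0]; exact hsurj
    rw [hmap] at him
    filter_upwards [him]
    rintro _ ⟨⟨X, v⟩, hv, rfl⟩
    refine ⟨X, X.2, v, v.2, hv, ?_⟩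
    have hfS : f (X, v) ∈ S := hS X X.2 _ (S.add_mem e.2 (hVS v.2))
    exact (congrArg Subtype.val (hP ⟨f (X, v), hfS⟩)).symm
  · rw [LinearMap.range_eq_top]
    intro y
    obtain ⟨X, hX, v, hv, hXv⟩ := hspan y y.2
    refine ⟨(⟨X, hX⟩, ⟨v, hv⟩), ?_⟩
    refine Eq.trans ?_ (hP y)
    rw [← hXv]
    simp [i₁, i₂]
    abel

end Conjugation

/-! ### The adjoint action -/

section Adjoint

variable {n : ℕ} {G : Subgroup (GL (Fin n) ℂ)} {hG : IsClosed (G : Set (GL (Fin n) ℂ))}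

instance : IsTopologicalAddGroup (lieAlg G hG) :=
  inferInstanceAs (IsTopologicalAddGroup (lieAlg G hG).toSubmodule)

instance : ContinuousSMul ℝ (lieAlg G hG) :=
  inferInstanceAs (ContinuousSMul ℝ (lieAlg G hG).toSubmodule)

theorem Ad_one (x : lieAlg G hG) : Ad 1 x = x :=
  Subtype.ext (by simp [Ad])

theorem Ad_mul (g k : G) (x : lieAlg G hG) : Ad (g * k) x = Ad g (Ad k x) :=
  Subtype.ext (by simp [Ad, mul_assoc])

theorem Ad_inv_Ad (g : G) (x : lieAlg G hG) : Ad g⁻¹ (Ad g x) = x := by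
  rw [← Ad_mul, inv_mul_cancel, Ad_one]

theorem Ad_Ad_inv (g : G) (x : lieAlg G hG) : Ad g (Ad g⁻¹ x) = x := by
  rw [← Ad_mul, mul_inv_cancel, Ad_one]

theorem Ad_add (g : G) (x y : lieAlg G hG) : Ad g (x + y) = Ad g x + Ad g y :=
  Subtype.ext (by simp [Ad, mul_add, add_mul])

theorem Ad_smul (g : G) (c : ℝ) (x : lieAlg G hG) : Ad g (c • x) = c • Ad g x :=
  Subtype.ext (by simp [Ad])

theorem Ad_lie (g : G) (x y : lieAlg G hG) : Ad g ⁅x, y⁆ = ⁅Ad g x, Ad g y⁆ :=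
  Subtype.ext (by
    simp only [Ad, LieSubalgebra.coe_bracket, Ring.lie_def, mul_sub, sub_mul, mul_assoc,
      Units.inv_mul_cancel_left])

theorem continuous_Ad (g : G) : Continuous (Ad g : lieAlg G hG → lieAlg G hG) := by
  refine Continuous.subtype_mk ?_ _
  exact (continuous_const.mul continuous_subtype_val).mul continuous_const

/-- The adjoint action as a linear equivalence. -/
def AdEquiv (g : G) : lieAlg G hG ≃ₗ[ℝ] lieAlg G hG where
  toFun := Ad g
  invFun := Ad g⁻¹
  map_add' := Ad_add g
  map_smul' := Ad_smul g
  left_inv := Ad_inv_Ad g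
  right_inv := Ad_Ad_inv g

theorem ad_Ad (g : G) (x : lieAlg G hG) :
    LieAlgebra.ad ℝ _ (Ad g x) = (AdEquiv g).conj (LieAlgebra.ad ℝ _ x) := by
  ext1 y
  rw [LinearEquiv.conj_apply_apply]
  show ⁅Ad g x, y⁆ = Ad g ⁅x, Ad g⁻¹ y⁆
  rw [Ad_lie, Ad_Ad_inv]

theorem IsNilpotentElt.smul {L : Type*} [LieRing L] [LieAlgebra ℝ L] {e : L}
    (he : IsNilpotentElt e) (c : ℝ) : IsNilpotentElt (c • e) := by
  rw [IsNilpotentElt, map_smul]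
  exact IsNilpotent.smul he c

theorem IsNilpotentElt.Ad {e : lieAlg G hG} (he : IsNilpotentElt e) (g : G) :
    IsNilpotentElt (Ad g e) := by
  rw [IsNilpotentElt, ad_Ad]
  exact he.map (LinearEquiv.conjRingEquiv (AdEquiv g))

theorem finrank_range_ad_Ad (g : G) (x : lieAlg G hG) :
    Module.finrank ℝ (LinearMap.range (LieAlgebra.ad ℝ _ (Ad g x))) =
      Module.finrank ℝ (LinearMap.range (LieAlgebra.ad ℝ _ x)) := by
  rw [ad_Ad, LinearEquiv.conj_apply, LinearMap.range_comp, LinearEquiv.range, Submodule.map_top,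
    LinearMap.range_comp]
  exact LinearEquiv.finrank_map_eq (AdEquiv g) _

theorem finrank_range_ad_smul {L : Type*} [LieRing L] [LieAlgebra ℝ L] (x : L) {c : ℝ}
    (hc : c ≠ 0) :
    Module.finrank ℝ (LinearMap.range (LieAlgebra.ad ℝ _ (c • x))) =
      Module.finrank ℝ (LinearMap.range (LieAlgebra.ad ℝ _ x)) := by
  rw [map_smul, LinearMap.range_smul _ _ hc]

/-- The one-parameter group generated by `h` scales eigenvectors of `ad h`. -/
theorem exists_Ad_eq_exp_smul (h : lieAlg G hG) (t : ℝ) :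
    ∃ g : G, ∀ (y : lieAlg G hG) (c : ℝ), ⁅h, y⁆ = c • y → Ad g y = Real.exp (t * c) • y := by
  let _ : NormedRing (Matrix (Fin n) (Fin n) ℂ) := Matrix.linftyOpNormedRing
  let _ : NormedAlgebra ℝ (Matrix (Fin n) (Fin n) ℂ) := Matrix.linftyOpNormedAlgebra
  obtain ⟨g, hg, hgt⟩ := h.2 t
  refine ⟨⟨g, hg⟩, fun y c hy => Subtype.ext ?_⟩
  have hy' : (h : Matrix (Fin n) (Fin n) ℂ) * y - y * h = c • (y : Matrix (Fin n) (Fin n) ℂ) :=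
    congrArg Subtype.val hy
  show (g : Matrix (Fin n) (Fin n) ℂ) * y * ((g⁻¹ : GL (Fin n) ℂ) : Matrix (Fin n) (Fin n) ℂ) =
    Real.exp (t * c) • (y : Matrix (Fin n) (Fin n) ℂ)
  have h1 : (g : Matrix (Fin n) (Fin n) ℂ) * (y : Matrix (Fin n) (Fin n) ℂ) =
      Real.exp (t * c) • ((y : Matrix (Fin n) (Fin n) ℂ) * g) := by
    rw [hgt]
    exact exp_smul_mul_of_lie_eq_smul hy' t
  rw [h1, smul_mul_assoc, mul_assoc, Units.mul_inv, mul_one]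

/-- If `V` is transverse to the orbit of `e`, every element near `e` is conjugate to an element
of `e + V` near `e`. -/
theorem eventually_exists_Ad_add (e : lieAlg G hG) (V : Submodule ℝ (lieAlg G hG))
    (hV : V ⊔ LinearMap.range (LieAlgebra.ad ℝ _ e) = ⊤) {U : Set (lieAlg G hG)}
    (hU : U ∈ 𝓝 0) : ∀ᶠ y in 𝓝 e, ∃ g : G, ∃ v ∈ V, v ∈ U ∧ Ad g (e + v) = y := by
  let _ : NormedRing (Matrix (Fin n) (Fin n) ℂ) := Matrix.linftyOpNormedRing
  let _ : NormedAlgebra ℝ (Matrix (Fin n) (Fin n) ℂ) := Matrix.linftyOpNormedAlgebra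
  have hconj : ∀ X ∈ (lieAlg G hG).toSubmodule, ∃ g : G, ∀ y : lieAlg G hG,
      (Ad g y : Matrix (Fin n) (Fin n) ℂ) =
        NormedSpace.exp X * (y : Matrix (Fin n) (Fin n) ℂ) * NormedSpace.exp (-X) := by
    intro X hX
    obtain ⟨g, hg, hgX⟩ := hX 1
    rw [one_smul] at hgX
    refine ⟨⟨g, hg⟩, fun y => ?_⟩
    have : ((g⁻¹ : GL (Fin n) ℂ) : Matrix (Fin n) (Fin n) ℂ) = NormedSpace.exp (-X) :=
      Units.inv_eq_of_mul_eq_one_right (by rw [hgX]; exact exp_mul_exp_neg X)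
    show (g : Matrix (Fin n) (Fin n) ℂ) * y * ((g⁻¹ : GL (Fin n) ℂ) : Matrix (Fin n) (Fin n) ℂ) = _
    rw [hgX, this]
  obtain ⟨U', hU', hUU'⟩ := mem_nhds_induced _ _ _ |>.1 hU
  have key := eventually_exists_conj_exp (lieAlg G hG).toSubmodule
    (V.map (lieAlg G hG).toSubmodule.subtype)
    (by rintro _ ⟨v, -, rfl⟩; exact v.2)
    (fun X hX Y hY => by
      obtain ⟨g, hg⟩ := hconj X hX
      exact (congrArg (· ∈ (lieAlg G hG).toSubmodule) (hg ⟨Y, hY⟩)).mp (Ad g ⟨Y, hY⟩).2)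
    e
    (fun y hy => by
      obtain ⟨v, hv, _, ⟨X, rfl⟩, h⟩ :=
        Submodule.mem_sup.1 (hV.symm ▸ Submodule.mem_top (x := (⟨y, hy⟩ : lieAlg G hG)))
      refine ⟨-X, Submodule.neg_mem _ X.2, v, ⟨v, hv, rfl⟩, ?_⟩
      have h' := congrArg Subtype.val h
      rw [← show _ = y from h']
      show _ = (v : Matrix (Fin n) (Fin n) ℂ) + (e * X - X * e)
      noncomm_ring)
    (U := U') hU'
  refine key.mono ?_
  rintro y ⟨X, hX, _, ⟨v, hv, rfl⟩, hvU, h⟩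
  obtain ⟨g, hg⟩ := hconj X hX
  exact ⟨g, v, hv, hUU' hvU, Subtype.ext ((hg _).trans h)⟩

end Adjoint

/-! ### Continuity of determinants -/

section Determinant

variable {L : Type*} [AddCommGroup L] [Module ℝ L] [FiniteDimensional ℝ L] [TopologicalSpace L]
  [IsTopologicalAddGroup L] [ContinuousSMul ℝ L] [T2Space L]

theorem continuous_det_sub {W : Type*} [AddCommGroup W] [Module ℝ W] [FiniteDimensional ℝ W]
    (A : Module.End ℝ W) (T : L →ₗ[ℝ] Module.End ℝ W) :
    Continuous fun y => LinearMap.det (A - T y) := by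
  let b := Module.finBasis ℝ W
  simp only [← LinearMap.det_toMatrix b, map_sub]
  refine Continuous.matrix_det (continuous_const.sub ?_)
  exact ((LinearMap.toMatrix b b).toLinearMap ∘ₗ T).continuous_of_finiteDimensional

/-- Transversality to a fixed subspace is an open condition. -/
theorem eventually_sup_range_eq_top {W : Type*} [AddCommGroup W] [Module ℝ W]
    [FiniteDimensional ℝ W] (T : L →ₗ[ℝ] Module.End ℝ W) {V : Submodule ℝ W} {e : L}
    (h : IsCompl V (LinearMap.range (T e))) :
    ∀ᶠ y in 𝓝 e, V ⊔ LinearMap.range (T y) = ⊤ := by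
  set R := LinearMap.range (T e)
  -- Compress `T y` to an endomorphism of `R` by a section of `T e` and the projection along `V`. It
  -- is the identity at `e`, so its determinant stays nonzero nearby.
  obtain ⟨σ, hσ⟩ := LinearMap.exists_rightInverse_of_surjective (T e).rangeRestrict
    (LinearMap.range_rangeRestrict _)
  let P := R.projectionOnto V h.symm
  let Ψ : L →ₗ[ℝ] Module.End ℝ R :=
    { toFun := fun y => P ∘ₗ T y ∘ₗ σ
      map_add' := fun y z => by ext; simp
      map_smul' := fun c y => by ext; simp }
  have hΨe : Ψ e = 1 := by
    ext1 r
    have h1 : T e (σ r) = r := congrArg Subtype.val (LinearMap.congr_fun hσ r)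
    show P (T e (σ r)) = r
    rw [h1]
    simp [P]
  have hcont := (continuous_det_sub 0 Ψ).tendsto e
  have hne : LinearMap.det (0 - Ψ e) ≠ 0 := by
    rw [hΨe, zero_sub, ← neg_one_smul ℝ, LinearMap.det_smul]
    simp
  filter_upwards [hcont.eventually_ne hne] with y hy
  have hsurj : Function.Surjective (0 - Ψ y : Module.End ℝ R) :=
    (LinearMap.equivOfDetNeZero _ hy).surjective
  refine eq_top_iff.2 fun w _ => ?_
  obtain ⟨r, hr⟩ := hsurj (P w)
  have h1 : P (w + T y (σ r)) = 0 := by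
    rw [map_add, ← hr]
    simp [Ψ]
  have h2 : w + T y (σ r) ∈ V := by
    rwa [← LinearMap.mem_ker, Submodule.ker_projectionOnto] at h1
  rw [show w = (w + T y (σ r)) + T y (-(σ r)) by rw [map_neg]; abel]
  exact Submodule.add_mem_sup h2 ⟨_, rfl⟩

end Determinant

/-! ### Orbits and their limits -/

section OrbitFacts

variable {n : ℕ} {G : Subgroup (GL (Fin n) ℂ)} {hG : IsClosed (G : Set (GL (Fin n) ℂ))}
  {x y z : lieAlg G hG}

theorem mem_orbit_self (x : lieAlg G hG) : x ∈ orbit x := ⟨1, Ad_one x⟩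

theorem Ad_mem_orbit (g : G) (h : y ∈ orbit x) : Ad g y ∈ orbit x := by
  obtain ⟨k, rfl⟩ := h
  exact ⟨g * k, Ad_mul g k x⟩

theorem orbit_eq_of_mem (h : y ∈ orbit x) : orbit y = orbit x := by
  obtain ⟨k, rfl⟩ := h
  refine Subset.antisymm ?_ ?_
  · rintro _ ⟨g, rfl⟩
    exact ⟨g * k, Ad_mul g k x⟩
  · rintro _ ⟨g, rfl⟩
    exact ⟨g * k⁻¹, by simp only [Ad_mul, Ad_inv_Ad]⟩

theorem orbit_subset_nilpotentCone (h : IsNilpotentElt x) :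
    orbit x ⊆ nilpotentCone (lieAlg G hG) := by
  rintro _ ⟨g, rfl⟩
  exact h.Ad g

theorem Ad_mem_closure {s : Set (lieAlg G hG)} (hs : ∀ g : G, ∀ y ∈ s, Ad g y ∈ s) (g : G)
    (hy : y ∈ closure s) : Ad g y ∈ closure s :=
  map_mem_closure (continuous_Ad g) hy fun y hy => hs g y hy

theorem mem_limitOrbits : y ∈ limitOrbits x ↔
    ∀ ε : ℝ, 0 < ε → y ∈ closure (⋃ ν ∈ Ioo (0 : ℝ) ε, orbit (ν • x)) := by
  simp [limitOrbits]

theorem isClosed_limitOrbits : IsClosed (limitOrbits x) :=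
  isClosed_iInter fun _ => isClosed_iInter fun _ => isClosed_closure

theorem Ad_mem_limitOrbits (g : G) (hy : y ∈ limitOrbits x) : Ad g y ∈ limitOrbits x := by
  rw [mem_limitOrbits] at hy ⊢
  refine fun ε hε => Ad_mem_closure (fun g z hz => ?_) g (hy ε hε)
  simp only [mem_iUnion] at hz ⊢
  obtain ⟨ν, hν, hz⟩ := hz
  exact ⟨ν, hν, Ad_mem_orbit g hz⟩

/-- A limit of points in the orbits of `ν x` as `ν → 0⁺` lies in the limit of orbits. -/
theorem mem_limitOrbits_of_tendsto {f : ℝ → lieAlg G hG} (hf : Tendsto f (𝓝[>] 0) (𝓝 y))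
    (h : ∀ ν, 0 < ν → f ν ∈ orbit (ν • x)) : y ∈ limitOrbits x := by
  rw [mem_limitOrbits]
  intro ε hε
  refine mem_closure_of_tendsto hf ?_
  filter_upwards [Ioo_mem_nhdsGT hε] with ν hν
  exact mem_iUnion₂.2 ⟨ν, hν, h ν hν.1⟩

theorem zero_mem_limitOrbits : (0 : lieAlg G hG) ∈ limitOrbits x := by
  refine mem_limitOrbits_of_tendsto (f := fun ν => ν • x) ?_ fun ν _ => mem_orbit_self _
  have : Tendsto (fun ν : ℝ => ν • x) (𝓝 0) (𝓝 ((0 : ℝ) • x)) :=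
    (continuous_id.smul continuous_const).tendsto 0
  rw [zero_smul] at this
  exact this.mono_left nhdsWithin_le_nhds

/-- Evaluating the characteristic polynomial at each real `t` turns nilpotency into a family of
closed conditions. -/
theorem isNilpotentElt_iff_det {L : Type*} [LieRing L] [LieAlgebra ℝ L] [FiniteDimensional ℝ L]
    {y : L} : IsNilpotentElt y ↔
      ∀ t : ℝ, LinearMap.det (algebraMap ℝ (Module.End ℝ L) t - LieAlgebra.ad ℝ L y) =
        t ^ Module.finrank ℝ L := by
  have h01 : IsNilpotentElt y ↔
      (LieAlgebra.ad ℝ L y).charpoly = Polynomial.X ^ Module.finrank ℝ L :=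
    (LinearMap.charpoly_nilpotent_tfae (LieAlgebra.ad ℝ L y)).out 0 1
  rw [h01]
  constructor
  · intro h t
    rw [← LinearMap.eval_charpoly, h]
    simp
  · intro h
    refine Polynomial.funext fun t => ?_
    rw [LinearMap.eval_charpoly, h]
    simp

theorem isClosed_nilpotentCone : IsClosed (nilpotentCone (lieAlg G hG)) := by
  simp only [nilpotentCone, isNilpotentElt_iff_det, ofPred_forall]
  exact isClosed_iInter fun t => isClosed_eq
    (continuous_det_sub _ (LieAlgebra.ad ℝ (lieAlg G hG)).toLinearMap) continuous_const

/-- Each value `D` of the characteristic polynomial of `ad` is continuous and constant on orbits, so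
on `G · (ν x)` it equals `D (ν x)`, which tends to `D 0`. A closed neighbourhood of `D 0` controls
the closures. -/
theorem limitOrbits_subset_nilpotentCone : limitOrbits x ⊆ nilpotentCone (lieAlg G hG) := by
  intro z hz
  refine isNilpotentElt_iff_det.2 fun t => ?_
  let T := (LieAlgebra.ad ℝ (lieAlg G hG)).toLinearMap
  let D : lieAlg G hG → ℝ := fun y => LinearMap.det (algebraMap ℝ (Module.End ℝ _) t - T y)
  have hD : Continuous D := continuous_det_sub _ T
  have hD0 : D 0 = t ^ Module.finrank ℝ (lieAlg G hG) :=
    isNilpotentElt_iff_det.1 (by simp [IsNilpotentElt]) t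
  have hDAd : ∀ (g : G) y, D (Ad g y) = D y := by
    intro g y
    have h1 : ∀ w, D w = (LieAlgebra.ad ℝ (lieAlg G hG) w).charpoly.eval t := fun w =>
      (LinearMap.eval_charpoly _ _).symm
    rw [h1, h1, ad_Ad, LinearEquiv.charpoly_conj]
  show D z = _
  rw [← hD0]
  by_contra hne
  obtain ⟨C, hC, hCc, hzC⟩ : ∃ C ∈ 𝓝 (D 0), IsClosed C ∧ D z ∉ C := by
    obtain ⟨C, hC, hCc, hCs⟩ := exists_mem_nhds_isClosed_subset
      (isOpen_ne.mem_nhds (Ne.symm hne) : {w | w ≠ D z} ∈ 𝓝 (D 0))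
    exact ⟨C, hC, hCc, fun h => hCs h rfl⟩
  have hcont : Tendsto (fun ν : ℝ => D (ν • x)) (𝓝 0) (𝓝 (D ((0 : ℝ) • x))) :=
    (hD.comp (continuous_id.smul continuous_const)).tendsto 0
  rw [zero_smul] at hcont
  obtain ⟨ε, hε, hεC⟩ := Metric.eventually_nhds_iff.1 (hcont hC)
  refine hzC (closure_minimal ?_ (hCc.preimage hD) (mem_limitOrbits.1 hz ε hε))
  rintro y hy
  obtain ⟨ν, hν, g, rfl⟩ := mem_iUnion₂.1 hy
  show D (Ad g (ν • x)) ∈ C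
  rw [hDAd]
  refine hεC ?_
  rw [dist_zero_right, Real.norm_of_nonneg hν.1.le]
  exact hν.2

variable [LieAlgebra.IsKilling ℝ (lieAlg G hG)]

theorem IsNilpotentElt.smul_mem_orbit (hx : IsNilpotentElt x) {ν : ℝ} (hν : 0 < ν) :
    ν • x ∈ orbit x := by
  obtain ⟨h, -, hh, -⟩ := hx.exists_triple
  -- The factor `1/2` compensates for `e` having weight `2`.
  obtain ⟨g, hg⟩ := exists_Ad_eq_exp_smul h (Real.log ν / 2)
  refine ⟨g, (hg x 2 hh).trans ?_⟩
  rw [div_mul_cancel₀ _ two_ne_zero, Real.exp_log hν]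

theorem IsNilpotentElt.limitOrbits_eq (hx : IsNilpotentElt x) :
    limitOrbits x = closure (orbit x) := by
  have h : ∀ ν : ℝ, 0 < ν → orbit (ν • x) = orbit x := fun ν hν =>
    orbit_eq_of_mem (hx.smul_mem_orbit hν)
  refine Subset.antisymm (fun y hy => ?_) fun y hy => mem_limitOrbits.2 fun ε hε => ?_
  · refine closure_mono ?_ (mem_limitOrbits.1 hy 1 one_pos)
    exact iUnion₂_subset fun ν hν => (h ν hν.1).subset
  · refine closure_mono ?_ hy
    have hm : ε / 2 ∈ Ioo 0 ε := ⟨half_pos hε, half_lt_self hε⟩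
    exact (h _ hm.1).superset.trans (subset_iUnion₂_of_subset _ hm Subset.rfl)

variable {s e : lieAlg G hG}

theorem IsJordanDecomposition.exists_Ad (hx : IsJordanDecomposition x s e) (t : ℝ) :
    ∃ g : G, Ad g s = s ∧ Ad g e = Real.exp t • e := by
  obtain ⟨h, hs, he⟩ := hx.exists_grading
  obtain ⟨g, hg⟩ := exists_Ad_eq_exp_smul h t
  exact ⟨g, by simpa using hg s 0 (by simpa using hs), by simpa using hg e 1 (by simpa using he)⟩

/-- The nilpotent part can be rescaled independently of `s`: `c = 1/ν` yields `x_n` in the limit,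
and `c → 0` yields the semisimple part in the orbit closure. -/
theorem IsJordanDecomposition.smul_add_mem_orbit (hx : IsJordanDecomposition x s e) (ν : ℝ)
    {c : ℝ} (hc : 0 < c) : ν • s + (ν * c) • e ∈ orbit (ν • x) := by
  obtain ⟨g, hs, he⟩ := hx.exists_Ad (Real.log c)
  refine ⟨g, ?_⟩
  show Ad g (ν • x) = _
  rw [hx.eq_add, smul_add, Ad_add, Ad_smul, Ad_smul, hs, he, Real.exp_log hc, smul_smul]

theorem IsJordanDecomposition.nilpotent_mem_limitOrbits (hx : IsJordanDecomposition x s e) :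
    e ∈ limitOrbits x := by
  refine mem_limitOrbits_of_tendsto (f := fun ν => ν • s + e) ?_ fun ν hν => ?_
  · have : Tendsto (fun ν : ℝ => ν • s + e) (𝓝 0) (𝓝 ((0 : ℝ) • s + e)) :=
      ((continuous_id.smul continuous_const).add continuous_const).tendsto 0
    rw [zero_smul, zero_add] at this
    exact this.mono_left nhdsWithin_le_nhds
  · have := hx.smul_add_mem_orbit ν (inv_pos.2 hν)
    rwa [mul_inv_cancel₀ hν.ne', one_smul] at this

theorem IsJordanDecomposition.smul_mem_closure_orbit (hx : IsJordanDecomposition x s e) (ν : ℝ) :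
    ν • s ∈ closure (orbit (ν • x)) := by
  have : Tendsto (fun c : ℝ => ν • s + (ν * c) • e) (𝓝 0) (𝓝 (ν • s + (ν * 0) • e)) :=
    (continuous_const.add ((continuous_const.mul continuous_id).smul continuous_const)).tendsto 0
  rw [mul_zero, zero_smul, add_zero] at this
  exact mem_closure_of_tendsto (this.mono_left nhdsWithin_le_nhds)
    (eventually_mem_nhdsWithin.mono fun c (hc : c ∈ Ioi (0 : ℝ)) => hx.smul_add_mem_orbit ν hc)

theorem IsJordanDecomposition.limitOrbits_subset (hx : IsJordanDecomposition x s e) :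
    limitOrbits s ⊆ limitOrbits x := by
  intro y hy
  rw [mem_limitOrbits] at hy ⊢
  intro ε hε
  refine closure_minimal ?_ isClosed_closure (hy ε hε)
  refine iUnion₂_subset fun ν hν => ?_
  rintro _ ⟨g, rfl⟩
  exact closure_mono (subset_iUnion₂_of_subset ν hν Subset.rfl)
    (Ad_mem_closure (fun g y hy => Ad_mem_orbit g hy) g (hx.smul_mem_closure_orbit ν))

end OrbitFacts

/-! ### Finiteness of the set of nilpotent orbits -/

section Finiteness

variable {n : ℕ} {G : Subgroup (GL (Fin n) ℂ)} {hG : IsClosed (G : Set (GL (Fin n) ℂ))}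

theorem exists_norm_lieAlg : ∃ q : lieAlg G hG → ℝ, Continuous q ∧ (∀ v, v ≠ 0 → 0 < q v) ∧
    (∀ (c : ℝ) v, q (c • v) = |c| * q v) ∧ IsCompact {v | q v = 1} := by
  let _ : NormedAddCommGroup (Matrix (Fin n) (Fin n) ℂ) := Matrix.linftyOpNormedAddCommGroup
  let _ : NormedSpace ℝ (Matrix (Fin n) (Fin n) ℂ) := Matrix.linftyOpNormedSpace
  have h := isCompact_sphere (0 : (lieAlg G hG).toSubmodule) 1
  have hS : {v : (lieAlg G hG).toSubmodule | ‖v‖ = 1} = Metric.sphere 0 1 := by ext; simp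
  refine ⟨fun v => ‖(v : Matrix (Fin n) (Fin n) ℂ)‖, continuous_norm.comp continuous_subtype_val,
    fun v hv => norm_pos_iff.2 fun h0 => hv (Subtype.ext h0), fun c v => ?_, hS ▸ h⟩
  exact norm_smul c (v : Matrix (Fin n) (Fin n) ℂ)

/-- The contracting flow on the transverse slice `e + ker (ad f)`. -/
theorem exists_slice_flow {q : lieAlg G hG → ℝ} (hq : Continuous q)
    (hpos : ∀ v, v ≠ 0 → 0 < q v) (hsmul : ∀ (c : ℝ) v, q (c • v) = |c| * q v)
    {e h f v : lieAlg G hG} (he : ⁅h, e⁆ = (2 : ℝ) • e) (hf : ⁅h, f⁆ = (-2 : ℝ) • f)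
    (hef : ⁅e, f⁆ = h) (hv : ⁅f, v⁆ = 0) (hv0 : v ≠ 0) :
    ∃ φ : ℝ → lieAlg G hG, Continuous φ ∧ φ 0 = v ∧ Tendsto φ atBot (𝓝 0) ∧
      Tendsto (fun t => q (φ t)) atTop atTop ∧
      ∀ t, ⁅f, φ t⁆ = 0 ∧ φ t ≠ 0 ∧ ∃ g : G, e + φ t = Real.exp (2 * t) • Ad g (e + v) := by
  obtain ⟨u, hu, huv⟩ := exists_weight_decomposition hf hef hv
  -- Conjugation by `exp (-t h)` multiplies the weight `-m` component by `exp (m t)` and `e` by `exp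
  -- (-2 t)`. The extra factor `exp (2 t)` fixes `e` and makes every exponent on the slice positive.
  let φ : ℝ → lieAlg G hG := fun t => ∑ m ∈ u.support, Real.exp ((2 + m) * t) • u m
  have hexp : ∀ m : ℕ, Continuous fun t : ℝ => Real.exp ((2 + m) * t) := fun m => by fun_prop
  refine ⟨φ, ?_, ?_, ?_, ?_, fun t => ?_⟩
  · exact continuous_finsetSum _ fun m _ => (hexp m).smul continuous_const
  · simpa [φ, Finsupp.sum] using huv
  · have h0 : (0 : lieAlg G hG) = ∑ m ∈ u.support, (0 : ℝ) • u m := by simp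
    rw [h0]
    refine tendsto_finsetSum _ fun m _ => Tendsto.smul ?_ tendsto_const_nhds
    exact Real.tendsto_exp_atBot.comp (tendsto_id.const_mul_atBot (by positivity))
  · have hne : u.support.Nonempty := by
      rw [Finsupp.support_nonempty_iff]
      rintro rfl
      exact hv0 (by simpa using huv.symm)
    -- As `t → ∞` the component with the largest `m` dominates; `ψ` is `φ` divided by its growth
    -- rate.
    set k := u.support.max' hne with hk
    have hkm : k ∈ u.support := u.support.max'_mem hne
    let ψ : ℝ → lieAlg G hG := fun t => ∑ m ∈ u.support, Real.exp (((m : ℝ) - k) * t) • u m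
    have hφψ : ∀ t, φ t = Real.exp ((2 + k) * t) • ψ t := by
      intro t
      simp only [φ, ψ, Finset.smul_sum, smul_smul, ← Real.exp_add]
      refine Finset.sum_congr rfl fun m _ => ?_
      congr 2
      ring
    have hψ : Tendsto ψ atTop (𝓝 (u k)) := by
      have h0 : u k = ∑ m ∈ u.support, (if m = k then (1 : ℝ) else 0) • u m := by
        simp [ite_smul, Finsupp.mem_support_iff.1 hkm]
      rw [h0]
      refine tendsto_finsetSum _ fun m hm => Tendsto.smul ?_ tendsto_const_nhds
      split_ifs with hmk
      · simp [hmk]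
      · have hlt : m < k := lt_of_le_of_ne (u.support.le_max' m hm) hmk
        have hlt' : (m : ℝ) - k < 0 := sub_neg.2 (by exact_mod_cast hlt)
        exact Real.tendsto_exp_atBot.comp (tendsto_id.const_mul_atTop_of_neg hlt')
    have hqψ := (hq.tendsto _).comp hψ
    have := (Real.tendsto_exp_atTop.comp
      (tendsto_id.const_mul_atTop (show (0 : ℝ) < 2 + k by positivity))).atTop_mul_pos
      (hpos _ (Finsupp.mem_support_iff.1 hkm)) hqψ
    refine this.congr fun t => ?_
    rw [hφψ, hsmul, abs_of_pos (Real.exp_pos _)]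
    rfl
  · obtain ⟨g, hg⟩ := exists_Ad_eq_exp_smul h (-t)
    have hge := hg e 2 he
    have hgv : φ t = Real.exp (2 * t) • Ad g v := by
      have : Ad g v = ∑ m ∈ u.support, Ad g (u m) := by
        rw [← huv, Finsupp.sum]
        exact map_sum (AdEquiv g) _ _
      rw [this, Finset.smul_sum]
      refine Finset.sum_congr rfl fun m _ => ?_
      rw [hg _ _ (hu m).1, smul_smul, ← Real.exp_add]
      congr 2
      ring
    refine ⟨?_, fun h0 => hv0 ?_, g, ?_⟩
    · simp only [φ, lie_sum, lie_smul, (hu _).2, smul_zero, Finset.sum_const_zero]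
    · rw [h0] at hgv
      have h1 := (smul_eq_zero.1 hgv.symm).resolve_left (Real.exp_ne_zero _)
      rw [← Ad_inv_Ad g v, h1]
      exact (AdEquiv g⁻¹).map_zero
    · rw [Ad_add, smul_add, ← hgv, hge, smul_smul, ← Real.exp_add]
      simp [mul_comm]

/-- The set of nilpotent orbits meeting a given set. -/
def nilpotentOrbitsMeeting (s : Set (lieAlg G hG)) : Set (Set (lieAlg G hG)) :=
  {O | ∃ z ∈ s, IsNilpotentElt z ∧ O = orbit z}

theorem nilpotentOrbitsMeeting_mono {s t : Set (lieAlg G hG)} (h : s ⊆ t) :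
    nilpotentOrbitsMeeting s ⊆ nilpotentOrbitsMeeting t :=
  fun _ ⟨z, hz, h'⟩ => ⟨z, h hz, h'⟩

variable [LieAlgebra.IsKilling ℝ (lieAlg G hG)]

/-- Flowing backwards brings `e + v` close to `e`, where transversality still holds and
`finrank_range_ad_lt` applies. Conjugation and nonzero scaling do not change the rank. -/
theorem finrank_range_ad_lt_of_slice {e h f v : lieAlg G hG} (he : ⁅h, e⁆ = (2 : ℝ) • e)
    (hf : ⁅h, f⁆ = (-2 : ℝ) • f) (hef : ⁅e, f⁆ = h) (hv : ⁅f, v⁆ = 0) (hv0 : v ≠ 0)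
    (hn : IsNilpotentElt (e + v)) :
    Module.finrank ℝ (LinearMap.range (LieAlgebra.ad ℝ _ e)) <
      Module.finrank ℝ (LinearMap.range (LieAlgebra.ad ℝ _ (e + v))) := by
  obtain ⟨q, hq, hpos, hsmul, -⟩ := exists_norm_lieAlg (G := G) (hG := hG)
  obtain ⟨φ, -, -, hφ, -, hφ'⟩ := exists_slice_flow hq hpos hsmul he hf hef hv hv0
  have hlim : Tendsto (fun t => e + φ t) atBot (𝓝 e) := by
    simpa using tendsto_const_nhds.add hφ
  obtain ⟨t, ht⟩ := (hlim.eventually (eventually_sup_range_eq_top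
    (LieAlgebra.ad ℝ (lieAlg G hG)).toLinearMap (isCompl_ker_ad_range_ad he hf hef))).exists
  obtain ⟨h1, h2, g, hg⟩ := hφ' t
  have hlt := finrank_range_ad_lt he hf hef h1 h2 (by rw [hg]; exact (hn.Ad g).smul _) ht
  rwa [hg, finrank_range_ad_smul _ (Real.exp_ne_zero _), finrank_range_ad_Ad] at hlt

theorem exists_nhds_finite_nilpotentOrbitsMeeting (e : lieAlg G hG) (hen : IsNilpotentElt e) :
    ∃ U ∈ 𝓝 e, (nilpotentOrbitsMeeting U).Finite := by
  induction hd : Module.finrank ℝ (lieAlg G hG) -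
    Module.finrank ℝ (LinearMap.range (LieAlgebra.ad ℝ _ e)) using Nat.strong_induction_on
    generalizing e with
  | _ d ih =>
  subst hd
  obtain ⟨h, f, he, hf, hef⟩ := hen.exists_triple
  obtain ⟨q, hq, hpos, hsmul, hcomp⟩ := exists_norm_lieAlg (G := G) (hG := hG)
  have hq0 : q 0 = 0 := by simpa using hsmul 0 0
  have hadd : Continuous fun v : lieAlg G hG => e + v := continuous_const.add continuous_id
  -- The nilpotent part of the unit sphere of the slice is compact, and the induction hypothesis
  -- applies at each of its points because the rank of `ad` is larger there.
  let K : Set (lieAlg G hG) := {v | q v = 1} ∩ {v | ⁅f, v⁆ = 0 ∧ IsNilpotentElt (e + v)}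
  have hK : IsCompact K := by
    refine hcomp.inter_right (IsClosed.inter ?_ (isClosed_nilpotentCone.preimage hadd))
    exact isClosed_singleton.preimage
      (LieAlgebra.ad ℝ (lieAlg G hG) f).continuous_of_finiteDimensional
  have hfin : (nilpotentOrbitsMeeting ((fun v => e + v) '' K)).Finite := by
    refine hK.induction_on (p := fun s => (nilpotentOrbitsMeeting ((fun v => e + v) '' s)).Finite)
      ?_ ?_ ?_ ?_
    · simp [nilpotentOrbitsMeeting]
    · exact fun s t hst ht => ht.subset (nilpotentOrbitsMeeting_mono (image_mono hst))
    · intro s t hs ht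
      refine (hs.union ht).subset ?_
      rintro _ ⟨_, ⟨v, hv | hv, rfl⟩, h'⟩
      · exact Or.inl ⟨_, ⟨v, hv, rfl⟩, h'⟩
      · exact Or.inr ⟨_, ⟨v, hv, rfl⟩, h'⟩
    · rintro v ⟨hv1, hv2, hv3⟩
      have hv0 : v ≠ 0 := by
        rintro rfl
        exact zero_ne_one (hq0.symm.trans hv1)
      have hlt := finrank_range_ad_lt_of_slice he hf hef hv2 hv0 hv3
      have hle := Submodule.finrank_le (LinearMap.range (LieAlgebra.ad ℝ (lieAlg G hG) (e + v)))
      obtain ⟨U, hU, hUf⟩ := ih _ (by omega) (e + v) hv3 rfl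
      refine ⟨_, mem_nhdsWithin_of_mem_nhds (hadd.continuousAt.preimage_mem_nhds hU), ?_⟩
      exact hUf.subset (nilpotentOrbitsMeeting_mono (image_preimage_subset _ _))
  have hU := eventually_exists_Ad_add e _ (isCompl_ker_ad_range_ad he hf hef).sup_eq_top
    (U := {v | q v < 1}) ((isOpen_Iio.preimage hq).mem_nhds (by simp [hq0]))
  refine ⟨_, hU, (hfin.union (finite_singleton (orbit e))).subset ?_⟩
  rintro _ ⟨_, ⟨g, v, hv, hvq, rfl⟩, hzn, rfl⟩
  have hvn : IsNilpotentElt (e + v) := by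
    rw [← Ad_inv_Ad g (e + v)]
    exact hzn.Ad _
  have hO : orbit (Ad g (e + v)) = orbit (e + v) := orbit_eq_of_mem ⟨g, rfl⟩
  rw [hO]
  by_cases hv0 : v = 0
  · right
    simp [hv0]
  · left
    -- The flow starts inside the unit ball and leaves it, so it crosses the sphere `q = 1`. It
    -- stays in the orbit of `e + v` since nilpotent orbits are stable under positive scaling.
    obtain ⟨φ, hφc, hφ0, -, hφt, hφ'⟩ := exists_slice_flow hq hpos hsmul he hf hef hv hv0
    obtain ⟨t₁, ht₁, ht₁'⟩ := ((eventually_ge_atTop (0 : ℝ)).and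
      (hφt.eventually_ge_atTop 1)).exists
    obtain ⟨t, -, ht⟩ := intermediate_value_Icc ht₁ (hq.comp hφc).continuousOn
      (show (1 : ℝ) ∈ Icc _ _ from ⟨by simpa [hφ0] using (le_of_lt hvq), ht₁'⟩)
    obtain ⟨h1, -, k, hk⟩ := hφ' t
    have hmem : e + φ t ∈ orbit (e + v) := by
      rw [hk, ← Ad_smul]
      exact Ad_mem_orbit k (hvn.smul_mem_orbit (Real.exp_pos _))
    exact ⟨e + φ t, ⟨φ t, ⟨ht, h1, orbit_subset_nilpotentCone hvn hmem⟩, rfl⟩,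
      orbit_subset_nilpotentCone hvn hmem, (orbit_eq_of_mem hmem).symm⟩

/-- There are finitely many nilpotent orbits. -/
theorem finite_nilpotentOrbits :
    (orbit '' nilpotentCone (lieAlg G hG)).Finite := by
  obtain ⟨U, hU, hUf⟩ := exists_nhds_finite_nilpotentOrbitsMeeting (0 : lieAlg G hG)
    (by simp [IsNilpotentElt])
  refine hUf.subset ?_
  rintro _ ⟨z, hz, rfl⟩
  have hlim : Tendsto (fun ν : ℝ => ν • z) (𝓝 0) (𝓝 ((0 : ℝ) • z)) :=
    (continuous_id.smul continuous_const).tendsto 0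
  rw [zero_smul] at hlim
  obtain ⟨ν, hν, hνU⟩ := ((eventually_mem_nhdsWithin (s := Ioi (0 : ℝ))).and
    ((hlim.mono_left nhdsWithin_le_nhds) hU)).exists
  have hmem := IsNilpotentElt.smul_mem_orbit hz hν
  exact ⟨ν • z, hνU, IsNilpotentElt.smul hz ν, (orbit_eq_of_mem hmem).symm⟩

theorem exists_finite_eq_iUnion_orbit {s : Set (lieAlg G hG)}
    (hs : s ⊆ nilpotentCone (lieAlg G hG)) (hst : ∀ g : G, ∀ y ∈ s, Ad g y ∈ s) :
    ∃ S : Set (lieAlg G hG), S.Finite ∧ S ⊆ nilpotentCone (lieAlg G hG) ∧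
      s = ⋃ e ∈ S, orbit e := by
  -- `S` contains exactly one representative of each orbit in `s`.
  obtain ⟨S, hSs, hS⟩ := exists_subset_bijOn s (orbit (G := G) (hG := hG))
  refine ⟨S, hS.finite_iff_finite.2 (finite_nilpotentOrbits.subset (image_mono hs)),
    hSs.trans hs, Subset.antisymm (fun y hy => ?_) (iUnion₂_subset fun e he => ?_)⟩
  · obtain ⟨e, he, hey⟩ := hS.surjOn ⟨y, hy, rfl⟩
    exact mem_iUnion₂.2 ⟨e, he, hey ▸ mem_orbit_self y⟩
  · rintro _ ⟨g, rfl⟩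
    exact hst g e (hSs he)

end Finiteness

end LimitOrbits

theorem proposition3p2 (n : ℕ) (G : Subgroup (GL (Fin n) ℂ))
    (hclosed : IsClosed (G : Set (GL (Fin n) ℂ)))
    (hconn : IsConnected (G : Set (GL (Fin n) ℂ)))
    (hsimple : LieAlgebra.IsSimple ℝ (LimitOrbits.lieAlg G hclosed))
    (x : LimitOrbits.lieAlg G hclosed) :
    -- (a) nonempty, closed, stable, contained in the nilpotent cone, finite union of orbits
    ((LimitOrbits.limitOrbits x).Nonempty ∧
      IsClosed (LimitOrbits.limitOrbits x) ∧
      (∀ g : G, ∀ z ∈ LimitOrbits.limitOrbits x, LimitOrbits.Ad g z ∈ LimitOrbits.limitOrbits x) ∧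
      LimitOrbits.limitOrbits x ⊆ LimitOrbits.nilpotentCone (LimitOrbits.lieAlg G hclosed) ∧
      ∃ S : Set (LimitOrbits.lieAlg G hclosed), S.Finite ∧
        S ⊆ LimitOrbits.nilpotentCone (LimitOrbits.lieAlg G hclosed) ∧
        LimitOrbits.limitOrbits x = ⋃ e ∈ S, LimitOrbits.orbit e) ∧
    (∀ xs xn : LimitOrbits.lieAlg G hclosed, LimitOrbits.IsJordanDecomposition x xs xn →
      -- (b) the nilpotent part and the closure of its orbit
      (xn ∈ LimitOrbits.limitOrbits x ∧
        closure (LimitOrbits.orbit xn) ⊆ LimitOrbits.limitOrbits x) ∧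
      -- (c) the semisimple part
      LimitOrbits.limitOrbits xs ⊆ LimitOrbits.limitOrbits x) ∧
    -- (d) nilpotent elements
    (LimitOrbits.IsNilpotentElt x →
      LimitOrbits.limitOrbits x = closure (LimitOrbits.orbit x)) := by
  have := hsimple
  have : LieAlgebra.IsKilling ℝ (LimitOrbits.lieAlg G hclosed) :=
    LimitOrbits.isKilling_of_isSimple (LimitOrbits.lieAlg G hclosed)
  refine ⟨⟨⟨0, LimitOrbits.zero_mem_limitOrbits⟩, LimitOrbits.isClosed_limitOrbits,
    fun g z hz => LimitOrbits.Ad_mem_limitOrbits g hz,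
    LimitOrbits.limitOrbits_subset_nilpotentCone,
    LimitOrbits.exists_finite_eq_iUnion_orbit LimitOrbits.limitOrbits_subset_nilpotentCone
      fun g z hz => LimitOrbits.Ad_mem_limitOrbits g hz⟩, fun xs xn hx => ⟨⟨?_, ?_⟩, ?_⟩, ?_⟩
  · exact hx.nilpotent_mem_limitOrbits
  · refine closure_minimal ?_ LimitOrbits.isClosed_limitOrbits
    rintro _ ⟨g, rfl⟩
    exact LimitOrbits.Ad_mem_limitOrbits g hx.nilpotent_mem_limitOrbits
  · exact hx.limitOrbits_subset
  · exact fun hx => hx.limitOrbits_eq
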